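/- **Setting.** Let $\Pi$ be a positive datalog program: a finite set of rules $q(\bar s)\leftarrow p_1(\bar s_1),\dots,p_\mu(\bar s_\mu)$ whose terms are variables (from an infinite supply) or constants, all of them safe (every head variable occurs in the body). A predicate is an IDB predicate if it is the head predicate of a rule with non-empty body; the other predicates of $\Pi$ are EDB predicates. $\#\mathsf{EDBs}$ is the number of EDB predicates and $\mathsf{ear}$ their maximum arity. For a database instance $D$ over the EDB predicates, the relation of a predicate is read off from the least fixpoint of the immediate consequence operator of $\Pi$ started with $D$ (facts that $\Pi$ contains for an EDB predicate count as tuples of its relation). An *adornment* $\rho$ of an IDB predicate $q$ is a rule with head predicate $q$ whose body is a set of EDB atoms, in which underscores "$\_$" (anonymous variables) may occur. The relaxation function $g_{\mathsf{out}}$ replaces in the body of $\rho$ every argument that is not a variable of the head by "$\_$", and then removes the atoms that have only underscores and the atoms $e(\bar t)$ for which another body atom $e(\bar t')$ satisfies, for each $i$, $t_i=t'_i$ or $t_i=\_$. The *adornment algorithm* starts with $\Pi'=\emptyset$ and repeats the following until nothing can be added. Choose a rule $q(\bar s)\leftarrow p_1(\bar s_1),\dots,p_\lambda(\bar s_\lambda),\mathcal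 E$ of $\Pi$ ($p_i$ IDB predicates, $\mathcal E$ EDB atoms), and for each $i\le\lambda$ a rule of $\Pi'$ with head $(p_i)_{\rho_i}(\bar v_i)$. Rename these heads, together with their adornments, to $(p_i)_{\rho'_i}(\bar v'_i)$ so that they and the chosen rule are pairwise variable-disjoint. Let $\sigma$ be a most general simultaneous unifier of the pairs $(\bar s_i,\bar v'_i)$ (if there is none, nothing is added), let $\mathcal B_i$ be the body of $\rho'_i$, and let $\rho=g_{\mathsf{out}}\bigl(q(\sigma\bar s)\leftarrow \sigma\mathcal B_1,\dots,\sigma\mathcal B_\lambda,\sigma\mathcal E\bigr)$. Add the rule $q_\rho(\sigma\bar s)\leftarrow (p_1)_{\rho_1}(\sigma\bar s_1),\dots,(p_\lambda)_{\rho_\lambda}(\sigma\bar s_\lambda),\sigma\mathcal E$ to $\Pi'$, unless $\Pi'$ contains a rule that is identical to it up to variable renaming (adornments of body atoms being compared up to renaming). The *integral edge-cover width* $\mathrm{ew}(\rho)$ is the least number of hyperedges $\mathrm{vars}(\bar t)$, with $e(\bar t)$ a body atom of $\rho$, that together contain all head variables of $\rho$. For an output $\Pi'$ of the algorithm, $\mathrm{ew}(q)$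 is the maximum of $\mathrm{ew}(\rho)$ over all adorned predicates $q_\rho$ that occur as head predicates in $\Pi'$ ($0$ if there are none). **Theorem.** (a) The algorithm has an output $\Pi'$ on every safe program $\Pi$. Let $\Pi'$ be any output, and let $q$ be an IDB predicate of $\Pi$ with arity $\mathrm{ar}(q)\ge 1$ such that the heads of the rules of $\Pi'$ for the predicates $q_\rho$ contain no constants (as is the case whenever $\Pi$ contains no constants). If every EDB relation has at most $N$ tuples, then the relation of $q$ satisfies $$|q|\;\le\;\sum_{k=1}^{\mathrm{ew}(q)} S(\mathrm{ar}(q),k)\cdot P(\#\mathsf{EDBs}\cdot N,k)\cdot \mathsf{ear}^{\mathrm{ar}(q)}\qquad(1)$$ $$\phantom{|q|}\;\le\;(\#\mathsf{EDBs}\cdot\mathsf{ear}\cdot\mathrm{ar}(q))^{\mathrm{ar}(q)}\cdot N^{\mathrm{ew}(q)},\qquad(2)$$ where $S(n,k)$ is the Stirling number of the second kind and $P(n,k)=n(n-1)\cdots(n-k+1)$. (b) Bound (1) is tight: for all integers $1\le\omega\le\mu$, $\nu\ge1$, $m\ge1$ there are a safe program $\Pi$ and an IDB predicate $q$ of $\Pi$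 with $\mathrm{ar}(q)=\mu$, such that $\#\mathsf{EDBs}=m$, every EDB predicate has arity $\nu$, every output $\Pi'$ of the algorithm has $\mathrm{ew}(q)=\omega$ and no constants in the heads of its rules for the predicates $q_\rho$, and for every $N\ge 0$ there is a database instance in which every EDB relation has exactly $N$ tuples and equality holds in (1). -/

import Mathlib

namespace Datalog

universe u v w

/-- A term of a rule: a variable or a constant. -/
inductive Term (V : Type v) (C : Type w) where
  | var : V → Term V C
  | const : C → Term V C

/-- An atom `p(t₁, …, t_{ar p})` whose arguments are taken from `T`. The arguments are terms in
rules, constants in ground atoms (facts), and `Option (Term V C)` in the bodies of adornments,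
where `none` is the underscore. -/
structure Atom {P : Type u} (ar : P → ℕ) (T : Type*) where
  pred : P
  args : Fin (ar pred) → T

def Atom.map {P : Type u} {ar : P → ℕ} {T T' : Type*} (f : T → T') (a : Atom ar T) :
    Atom ar T' :=
  ⟨a.pred, fun i => f (a.args i)⟩

/-- Application of a substitution to a term. -/
def Term.subst {V : Type v} {C : Type w} (σ : V → Term V C) : Term V C → Term V C
  | .var x => σ x
  | .const c => .const c

/-- Application of a ground substitution to a term. -/
def Term.ground {V : Type v} {C : Type w} (τ : V → C) : Term V C → C
  | .var x => τ x
  | .const c => c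

/-- Renaming of the variables of a term. -/
def Term.rename {V : Type v} {C : Type w} (π : Equiv.Perm V) : Term V C → Term V C
  | .var x => .var (π x)
  | .const c => .const c

section AtomVars

variable {P : Type u} {ar : P → ℕ} {V : Type v} {C : Type w}

/-- The variables of an atom. -/
def Atom.vars (a : Atom ar (Term V C)) : Set V := {x | ∃ i, a.args i = .var x}

/-- The variables of an atom with underscores (an underscore is an anonymous variable that occurs
nowhere else; it is not listed). -/
def Atom.namedVars (a : Atom ar (Option (Term V C))) : Set V := {x | ∃ i, a.args i = some (.var x)}

end AtomVars

/-- A datalog rule `head ← body`. -/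
structure Rule {P : Type u} (ar : P → ℕ) (V : Type v) (C : Type w) where
  head : Atom ar (Term V C)
  body : List (Atom ar (Term V C))

/-- A datalog program is a finite set of rules. -/
abbrev Program {P : Type u} (ar : P → ℕ) (V : Type v) (C : Type w) := Finset (Rule ar V C)

section Programs

variable {P : Type u} {ar : P → ℕ} {V : Type v} {C : Type w}

/-- The variables of a rule. -/
def Rule.vars (R : Rule ar V C) : Set V := {x | x ∈ R.head.vars ∨ ∃ a ∈ R.body, x ∈ a.vars}

/-- A rule is safe if every variable of the head occurs in the body. -/
def Rule.Safe (R : Rule ar V C) : Prop := ∀ x ∈ R.head.vars, ∃ a ∈ R.body, x ∈ a.vars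

/-- A program is safe if all its rules are. -/
def Program.Safe (prog : Program ar V C) : Prop := ∀ R ∈ prog, R.Safe

/-- An IDB predicate: the head predicate of some rule with a non-empty body. -/
def Program.IsIDB (prog : Program ar V C) (p : P) : Prop :=
  ∃ R ∈ prog, R.head.pred = p ∧ R.body ≠ []

/-- The EDB predicates: the predicates of the program that are not IDB predicates. -/
def Program.edbs (prog : Program ar V C) : Set P :=
  {p | (∃ R ∈ prog, R.head.pred = p ∨ ∃ a ∈ R.body, a.pred = p) ∧ ¬ prog.IsIDB p}

/-- The number of EDB predicates. -/
noncomputable def Program.numEDBs (prog : Program ar V C) : ℕ := prog.edbs.ncard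

/-- The maximum arity of an EDB predicate. -/
noncomputable def Program.ear (prog : Program ar V C) : ℕ := sSup (ar '' prog.edbs)

/-- The immediate consequence operator of a program over a database instance `D`, given as a set
of ground atoms. Only the atoms of `D` with an EDB predicate are used. -/
def Program.immediateConsequence (prog : Program ar V C) (D : Set (Atom ar C)) :
    Set (Atom ar C) →o Set (Atom ar C) where
  toFun I := {A | A ∈ D ∧ A.pred ∈ prog.edbs} ∪
    {A | ∃ R ∈ prog, ∃ τ : V → C, (∀ B ∈ R.body, B.map (Term.ground τ) ∈ I) ∧
      A = R.head.map (Term.ground τ)}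
  monotone' := by
    intro I J hIJ A hA
    rcases hA with hA | ⟨R, hR, τ, hB, rfl⟩
    · exact Or.inl hA
    · exact Or.inr ⟨R, hR, τ, fun B hBm => hIJ (hB B hBm), rfl⟩

/-- The relation of the predicate `p` that `prog` derives from `D`: the tuples `t` such that
`p(t)` is in the least fixpoint of the immediate consequence operator. For an EDB predicate this is
the relation stored in `D`, together with the facts on `p` (rules with an empty body) that the
program itself contains, if any. -/
def Program.relation (prog : Program ar V C) (D : Set (Atom ar C)) (p : P) :
    Set (Fin (ar p) → C) :=
  {t | (⟨p, t⟩ : Atom ar C) ∈ OrderHom.lfp (prog.immediateConsequence D)}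

open Classical in
/-- The IDB atoms of the body of a rule. -/
noncomputable def Program.idbBody (prog : Program ar V C) (R : Rule ar V C) :
    List (Atom ar (Term V C)) :=
  R.body.filter fun a => prog.IsIDB a.pred

open Classical in
/-- The EDB atoms of the body of a rule. -/
noncomputable def Program.edbBody (prog : Program ar V C) (R : Rule ar V C) :
    List (Atom ar (Term V C)) :=
  R.body.filter fun a => ¬ prog.IsIDB a.pred

/-- `σ` is a simultaneous unifier of a set of pairs of atoms. -/
def IsUnifier (S : Set (Atom ar (Term V C) × Atom ar (Term V C))) (σ : V → Term V C) : Prop :=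
  ∀ p ∈ S, p.1.map (Term.subst σ) = p.2.map (Term.subst σ)

/-- `σ` is a most general simultaneous unifier: every unifier is obtained from it by further
instantiation. -/
def IsMGU (S : Set (Atom ar (Term V C) × Atom ar (Term V C))) (σ : V → Term V C) : Prop :=
  IsUnifier S σ ∧ ∀ τ, IsUnifier S τ → ∃ θ : V → Term V C, ∀ x, Term.subst θ (σ x) = τ x

end Programs

/-- An adornment: a rule whose body consists of EDB atoms, in which underscores may occur. The body
is a set of atoms. -/
structure Adornment {P : Type u} (ar : P → ℕ) (V : Type v) (C : Type w) where
  head : Atom ar (Term V C)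
  body : Finset (Atom ar (Option (Term V C)))

/-- An EDB-adorned atom `q_ρ(t)`. -/
structure AdornedAtom {P : Type u} (ar : P → ℕ) (V : Type v) (C : Type w) where
  atom : Atom ar (Term V C)
  adornment : Adornment ar V C

/-- An EDB-adorned rule: the head and the IDB atoms of the body are adorned. -/
structure AdornedRule {P : Type u} (ar : P → ℕ) (V : Type v) (C : Type w) where
  head : AdornedAtom ar V C
  idbBody : List (AdornedAtom ar V C)
  edbBody : List (Atom ar (Term V C))

/-- An EDB-adorned program is a finite set of EDB-adorned rules. -/
abbrev AdornedProgram {P : Type u} (ar : P → ℕ) (V : Type v) (C : Type w) :=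
  Finset (AdornedRule ar V C)

section Adorning

variable {P : Type u} {ar : P → ℕ} {V : Type v} {C : Type w}

open Classical in
noncomputable def Adornment.rename (π : Equiv.Perm V) (ρ : Adornment ar V C) : Adornment ar V C :=
  ⟨ρ.head.map (Term.rename π), ρ.body.image fun a => a.map (Option.map (Term.rename π))⟩

noncomputable def AdornedAtom.rename (π : Equiv.Perm V) (A : AdornedAtom ar V C) :
    AdornedAtom ar V C :=
  ⟨A.atom.map (Term.rename π), A.adornment.rename π⟩

/-- All variables of an adorned atom, those of its adornment included. -/
def AdornedAtom.vars (A : AdornedAtom ar V C) : Set V :=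
  {x | x ∈ A.atom.vars ∨ x ∈ A.adornment.head.vars ∨ ∃ a ∈ A.adornment.body, x ∈ a.namedVars}

open Classical in
/-- Replace an argument by an underscore unless it is a variable in `O`. -/
noncomputable def maskArg (O : Set V) : Option (Term V C) → Option (Term V C)
  | some (.var x) => if x ∈ O then some (.var x) else none
  | some (.const _) => none
  | none => none

/-- `a` imposes at most the restrictions of `b`: both have the same predicate, and each argument of
`a` is an underscore or equals the corresponding argument of `b`. -/
def LessRestrictive (a b : Atom ar (Option (Term V C))) : Prop :=
  ∃ (p : P) (s t : Fin (ar p) → Option (Term V C)), a = ⟨p, s⟩ ∧ b = ⟨p, t⟩ ∧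
    ∀ i, s i = t i ∨ s i = none

open Classical in
/-- The relaxation function `g_out`: every argument of a body atom that is not a variable of the
head becomes an underscore; then the atoms that have only underscores, and the atoms that are less
restrictive than some other atom, are removed. -/
noncomputable def gOut (ρ : Adornment ar V C) : Adornment ar V C :=
  let B := ρ.body.image fun a => a.map (maskArg ρ.head.vars)
  ⟨ρ.head, B.filter fun a =>
    (∃ i, a.args i ≠ none) ∧ ∀ b ∈ B, LessRestrictive a b → b = a⟩

/-- Two adorned rules are identical up to variable renaming. The adornment of a body atom is a part
of the predicate symbol, so its variables are not tied to those of the rule. -/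
def AdornedRule.SameUpToRenaming (R R' : AdornedRule ar V C) : Prop :=
  ∃ π : Equiv.Perm V, R.head.rename π = R'.head ∧
    List.Forall₂ (fun A B : AdornedAtom ar V C => A.atom.map (Term.rename π) = B.atom ∧
      ∃ π' : Equiv.Perm V, A.adornment.rename π' = B.adornment) R.idbBody R'.idbBody ∧
    R.edbBody.map (Atom.map (Term.rename π)) = R'.edbBody

/-- The membership checking function `h_eq`. -/
def hEq (R : AdornedRule ar V C) (adn : AdornedProgram ar V C) : Prop :=
  ∃ R' ∈ adn, AdornedRule.SameUpToRenaming R R'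

open Classical in
/-- The adornment `ρ₀` (before relaxation) that is made from the rule `R`, the chosen head atoms
`A i` (already renamed) for the IDB atoms of `R`, and the unifier `σ`. -/
noncomputable def inlinedAdornment (prog : Program ar V C) (R : Rule ar V C)
    (A : Fin (prog.idbBody R).length → AdornedAtom ar V C) (σ : V → Term V C) :
    Adornment ar V C :=
  ⟨R.head.map (Term.subst σ),
    (Finset.univ.biUnion fun i =>
      (A i).adornment.body.image fun a => a.map (Option.map (Term.subst σ))) ∪
    ((prog.edbBody R).map fun a => a.map fun t => some (Term.subst σ t)).toFinset⟩

/-- `R'` is an adorned rule that one pass through the loop body of the adornment algorithm, with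
relaxation function `g`, constructs from a rule `R` of `prog` and from rules `c i` in the current
adorned program `adn`, one for each IDB atom in the body of `R`. The permutation `π i` renames the
head of `c i`, and `σ` is the chosen mgu. -/
def Constructs (g : Adornment ar V C → Adornment ar V C) (prog : Program ar V C)
    (adn : AdornedProgram ar V C) (R' : AdornedRule ar V C) : Prop :=
  ∃ R ∈ prog, ∃ (c : Fin (prog.idbBody R).length → AdornedRule ar V C)
    (π : Fin (prog.idbBody R).length → Equiv.Perm V) (σ : V → Term V C),
    (∀ i, c i ∈ adn ∧ (c i).head.atom.pred = ((prog.idbBody R).get i).pred) ∧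
    (∀ i, Disjoint R.vars ((c i).head.rename (π i)).vars) ∧
    (∀ i j, i ≠ j →
      Disjoint ((c i).head.rename (π i)).vars ((c j).head.rename (π j)).vars) ∧
    IsMGU (Set.range fun i => ((prog.idbBody R).get i, ((c i).head.rename (π i)).atom)) σ ∧
    R' = ⟨⟨R.head.map (Term.subst σ),
            g (inlinedAdornment prog R (fun i => (c i).head.rename (π i)) σ)⟩,
          List.ofFn fun i => ⟨((prog.idbBody R).get i).map (Term.subst σ), (c i).head.adornment⟩,
          (prog.edbBody R).map (Atom.map (Term.subst σ))⟩

open Classical in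
/-- One step of the algorithm: a constructed rule that fails the membership check is added. -/
def AlgorithmStep (g : Adornment ar V C → Adornment ar V C)
    (h : AdornedRule ar V C → AdornedProgram ar V C → Prop) (prog : Program ar V C)
    (adn adn' : AdornedProgram ar V C) : Prop :=
  ∃ R', Constructs g prog adn R' ∧ ¬ h R' adn ∧ adn' = insert R' adn

/-- `adn` is an output of the adornment algorithm with parameters `g` and `h` on input `prog`: it is
reached from the empty program by finitely many steps, and no further rule can be added. The choices
that the algorithm leaves open (order of the loops, renamings, mgus) are arbitrary. -/
def IsAlgorithmOutput (g : Adornment ar V C → Adornment ar V C)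
    (h : AdornedRule ar V C → AdornedProgram ar V C → Prop) (prog : Program ar V C)
    (adn : AdornedProgram ar V C) : Prop :=
  Relation.ReflTransGen (AlgorithmStep g h prog) ∅ adn ∧ ∀ R', Constructs g prog adn R' → h R' adn

/-- The integral edge cover number: the least number of hyperedges in `E` that together contain all
vertices in `out`. -/
noncomputable def edgeCoverNumber (E : Set (Set V)) (out : Set V) : ℕ :=
  sInf {n | ∃ S : Finset (Set V), (S : Set (Set V)) ⊆ E ∧ (∀ x ∈ out, ∃ e ∈ S, x ∈ e) ∧ S.card = n}

/-- The integral edge-cover width of an adornment: the edge cover number of its hypergraph, which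
has a hyperedge for each body atom, with respect to the variables of the head. -/
noncomputable def Adornment.ew (ρ : Adornment ar V C) : ℕ :=
  edgeCoverNumber {e | ∃ a ∈ ρ.body, e = a.namedVars} ρ.head.vars

open Classical in
/-- The integral edge-cover width `ew(q)`: the maximum of `ew(ρ)` over the adorned versions `q_ρ` of
`q` in the adorned program. -/
noncomputable def AdornedProgram.ew (adn : AdornedProgram ar V C) (q : P) : ℕ :=
  (adn.filter fun R => R.head.atom.pred = q).sup fun R => R.head.adornment.ew

/-- In the rules for adorned versions of `q`, all arguments of the head are variables. -/
def AdornedProgram.VariableHeads (adn : AdornedProgram ar V C) (q : P) : Prop :=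
  ∀ R ∈ adn, R.head.atom.pred = q → ∀ i, ∃ x, R.head.atom.args i = .var x

end Adorning

/-- The sum `∑_{k=1}^{w} S(a, k) · P(m N, k) · r^a`, with Stirling numbers of the second kind `S`
and permutation numbers `P`. -/
def sizeBound (w a m r N : ℕ) : ℕ :=
  ∑ k ∈ Finset.Icc 1 w, Nat.stirlingSecond a k * (m * N).descFactorial k * r ^ a

end Datalog

open Datalog

/-! The size bound is a decoding argument. By induction on the least fixpoint, every derived IDB
fact is an instance of the head of some output rule, under a valuation for which each body atom of
its adornment agrees with an EDB fact outside the underscores (`exists_represents`). Safety and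
relaxation keep every head variable in the adornment body (`covered_inlinedAdornment`,
`Adornment.Covered.gOut`), so some `ew` body atoms cover the head. If the head has only variables,
each argument of the derived fact can therefore be read off one of at most `ew q` EDB facts. A tuple
of `q` is thus determined by two functions on its positions: one into the EDB facts with at most `ew
q` values, and one into the at most `ear` argument positions. There are `S(a, k) * P(n, k)`
functions from `a` points to `n` points with exactly `k` values, which gives (1). Since the sum of
the Stirling numbers is at most `a ^ a`, (2) follows.

An output exists because an adorned rule has no more variables than the program rule it comes from:
unification only merges variables or replaces them by constants of the program, and relaxation
discards variables outside the head. Up to renaming there are finitely many such rules.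

For tightness, no recursion is needed. The program joins `ω` variable-disjoint EDB atoms in all
possible ways, and the facts of the instance share no constants, so that decoding is injective. Its
width is then forced to be `ω`, because a smaller width would contradict the upper bound already
proved. -/

namespace Datalog

universe u v w

/-! ### Counting functions by the size of their range. -/

section Counting

open Finset

/-- Either `x` is one of `k + 1` old values or one of the `card α - k` new ones. These two counts
become the two terms of the recurrence for Stirling numbers of the second kind. -/
lemma card_filter_card_insert {α : Type*} [Fintype α] [DecidableEq α] (s : Finset α) (k : ℕ) :
    #{x : α | #(insert x s) = k + 1} =
      (if #s = k + 1 then k + 1 else 0) + (if #s = k then Fintype.card α - k else 0) := by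
  have h : ∀ x : α, #(insert x s) = k + 1 ↔ (x ∈ s ∧ #s = k + 1) ∨ (x ∈ sᶜ ∧ #s = k) := by
    intro x
    by_cases hx : x ∈ s
    · simp [hx]
    · simp [hx]
  by_cases h1 : #s = k + 1
  · have : ({x : α | #(insert x s) = k + 1} : Finset α) = s := by
      ext x
      simp [h, h1]
    rw [this]
    simp [h1]
  · by_cases h2 : #s = k
    · have : ({x : α | #(insert x s) = k + 1} : Finset α) = sᶜ := by
        ext x
        simp [h, h2]
      rw [this, card_compl]
      simp [h2]
    · simp [h, h1, h2]

/-- The number of functions from `Fin a` whose range has exactly `k` elements. -/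
lemma card_functions_card_image_eq (α : Type*) [Fintype α] [DecidableEq α] (a k : ℕ) :
    #{g : Fin a → α | #(univ.image g) = k} =
      Nat.stirlingSecond a k * (Fintype.card α).descFactorial k := by
  induction a generalizing k with
  | zero =>
    cases k with
    | zero => simp
    | succ k => simp
  | succ a ih =>
    have himg : ∀ (x : α) (g : Fin a → α),
        univ.image (Fin.cons x g : Fin (a + 1) → α) = insert x (univ.image g) := by
      intro x g
      ext y
      simp [Fin.exists_fin_succ, eq_comm]
    cases k with
    | zero => simp [Finset.univ_nonempty.ne_empty]
    | succ k =>
      -- Split off the value at `0` and count, for each tail `g`, the admissible first values.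
      have hsum : #{g : Fin (a + 1) → α | #(univ.image g) = k + 1} =
          ∑ g : Fin a → α, #{x : α | #(insert x (univ.image g)) = k + 1} := by
        simp_rw [card_filter]
        rw [← (Fin.consEquiv fun _ : Fin (a + 1) => α).sum_comp, Fintype.sum_prod_type,
          sum_comm]
        refine sum_congr rfl fun g _ => sum_congr rfl fun x _ => ?_
        rw [← himg]
        rfl
      rw [hsum]
      simp_rw [card_filter_card_insert]
      rw [sum_add_distrib, ← sum_filter, ← sum_filter, sum_const, sum_const, ih, ih,
        Nat.stirlingSecond_succ_succ, Nat.descFactorial_succ]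
      simp only [smul_eq_mul]
      ring

lemma card_functions_card_image_le (α : Type*) [Fintype α] [DecidableEq α] {a : ℕ} (ha : 0 < a)
    (w : ℕ) :
    #{g : Fin a → α | #(univ.image g) ≤ w} =
      ∑ k ∈ Icc 1 w, Nat.stirlingSecond a k * (Fintype.card α).descFactorial k := by
  have : NeZero a := ⟨ha.ne'⟩
  simp_rw [← card_functions_card_image_eq]
  rw [← card_biUnion]
  · congr 1
    ext g
    simpa [Nat.one_le_iff_ne_zero] using fun _ => Finset.univ_nonempty.ne_empty
  · intro i _ j _ hij
    refine disjoint_left.2 fun g hg hg' => hij ?_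
    simp only [mem_filter] at hg hg'
    exact hg.2.symm.trans hg'.2

lemma sizeBound_eq_card (α : Type*) [Fintype α] [DecidableEq α] {a : ℕ} (ha : 0 < a)
    (w m r N : ℕ) (hα : Fintype.card α = m * N) :
    sizeBound w a m r N =
      #(({g : Fin a → α | #(univ.image g) ≤ w} : Finset _) ×ˢ
        (univ : Finset (Fin a → Fin r))) := by
  rw [card_product, card_functions_card_image_le α ha, sizeBound, hα, sum_mul]
  simp

lemma card_le_sizeBound (α : Type*) [Fintype α] [DecidableEq α] {a : ℕ} (ha : 0 < a)
    (w m r N : ℕ) (hα : Fintype.card α ≤ m * N) :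
    #(({g : Fin a → α | #(univ.image g) ≤ w} : Finset _) ×ˢ
        (univ : Finset (Fin a → Fin r))) ≤ sizeBound w a m r N := by
  -- The exact count applies with `card α` and `1` in place of `m` and `N`; the falling factorial is
  -- monotone in its base.
  rw [← sizeBound_eq_card α ha w (Fintype.card α) r 1 (mul_one _).symm, sizeBound, sizeBound,
    mul_one]
  gcongr

/-- Weighting each term by the falling factorial of `a`, which is positive for `k ≤ a`, turns the
sum into a count of self-maps of `Fin a`. -/
lemma sum_stirlingSecond_le (a w : ℕ) : ∑ k ∈ Icc 1 w, Nat.stirlingSecond a k ≤ a ^ a := by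
  rcases Nat.eq_zero_or_pos a with rfl | ha
  · refine (Finset.sum_eq_zero fun k hk => ?_).le.trans (Nat.zero_le _)
    exact Nat.stirlingSecond_eq_zero_of_lt (by simp at hk; omega)
  calc ∑ k ∈ Icc 1 w, Nat.stirlingSecond a k
      ≤ ∑ k ∈ Icc 1 w, Nat.stirlingSecond a k * (Fintype.card (Fin a)).descFactorial k := by
        refine sum_le_sum fun k _ => ?_
        rcases lt_or_ge a k with h | h
        · simp [Nat.stirlingSecond_eq_zero_of_lt h]
        · refine Nat.le_mul_of_pos_right _ (Nat.pos_of_ne_zero fun h0 => ?_)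
          rw [Fintype.card_fin, Nat.descFactorial_eq_zero_iff_lt] at h0
          omega
    _ = #{g : Fin a → Fin a | #(univ.image g) ≤ w} := (card_functions_card_image_le _ ha w).symm
    _ ≤ a ^ a := (card_le_univ _).trans (by simp)

lemma sizeBound_le_pow (w a m r N : ℕ) :
    sizeBound w a m r N ≤ (m * r * a) ^ a * N ^ w := by
  -- If `m * N = 0`, all terms vanish because `k ≥ 1`. Otherwise `m` and `N` are positive, so their
  -- exponents `k` may be raised to `a` and `w`.
  rcases Nat.eq_zero_or_pos (m * N) with h0 | hpos
  · refine (Finset.sum_eq_zero fun k hk => ?_).le.trans (Nat.zero_le _)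
    rw [h0, Nat.descFactorial_of_lt (by simp at hk; omega)]
    simp
  have hm : 0 < m := Nat.pos_of_mul_pos_right hpos
  have hN : 0 < N := Nat.pos_of_mul_pos_left hpos
  calc sizeBound w a m r N
      ≤ ∑ k ∈ Icc 1 w, Nat.stirlingSecond a k * (m ^ a * N ^ w * r ^ a) := by
        refine sum_le_sum fun k hk => ?_
        rcases lt_or_ge a k with h | h
        · simp [Nat.stirlingSecond_eq_zero_of_lt h]
        · rw [mul_assoc]
          gcongr
          calc (m * N).descFactorial k ≤ (m * N) ^ k := Nat.descFactorial_le_pow _ _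
            _ = m ^ k * N ^ k := mul_pow _ _ _
            _ ≤ m ^ a * N ^ w := by
              have := (mem_Icc.1 hk).2
              gcongr
    _ = (∑ k ∈ Icc 1 w, Nat.stirlingSecond a k) * (m ^ a * N ^ w * r ^ a) := (sum_mul ..).symm
    _ ≤ a ^ a * (m ^ a * N ^ w * r ^ a) := by
        gcongr
        exact sum_stirlingSecond_le a w
    _ = (m * r * a) ^ a * N ^ w := by ring

lemma stirlingSecond_pos {a k : ℕ} (hk : 1 ≤ k) (hka : k ≤ a) : 0 < Nat.stirlingSecond a k := by
  induction a generalizing k with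
  | zero => omega
  | succ a ih =>
    obtain ⟨k, rfl⟩ := Nat.exists_eq_add_of_le' hk
    rw [Nat.stirlingSecond_succ_succ]
    rcases Nat.lt_or_ge a (k + 1) with h | h
    · obtain rfl : k = a := by omega
      rw [Nat.stirlingSecond_self]
      omega
    · have := ih (by omega) h
      positivity

/-- The summand at `w'` is positive. This strictness lets the size of a relation detect the width in
the tightness part. -/
lemma sizeBound_lt_of_lt {w w' a m r N : ℕ} (h : w < w') (hw : w' ≤ a) (hr : 0 < r)
    (hN : w' ≤ m * N) : sizeBound w a m r N < sizeBound w' a m r N := by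
  refine sum_lt_sum_of_subset (Icc_subset_Icc_right h.le) (i := w') ?_ ?_ ?_ ?_
  · simp; omega
  · simp; omega
  · have h1 := stirlingSecond_pos (by omega : 1 ≤ w') hw
    have h2 : 0 < (m * N).descFactorial w' := Nat.descFactorial_pos.2 hN
    positivity
  · intros
    exact Nat.zero_le _

end Counting

/-! ### Renaming of atoms and adornments, and finiteness of their variables. -/

section Substitutions

variable {P : Type u} {ar : P → ℕ} {V : Type v} {C : Type w}

lemma Atom.map_map {T T' T'' : Type*} (f : T → T') (g : T' → T'') (a : Atom ar T) :
    (a.map f).map g = a.map (g ∘ f) := rfl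

lemma Atom.map_congr {T T' : Type*} {f g : T → T'} {a : Atom ar T}
    (h : ∀ i, f (a.args i) = g (a.args i)) : a.map f = a.map g := by
  simp only [Atom.map]
  congr 1
  exact funext h

lemma Atom.args_of_map_eq {T T' T'' : Type*} {f : T → T''} {g : T' → T''} {a : Atom ar T}
    {b : Atom ar T'} (h : a.map f = b.map g) :
    ∃ e : a.pred = b.pred, ∀ i, f (a.args i) = g (b.args (e ▸ i)) := by
  obtain ⟨p, s⟩ := a
  obtain ⟨q, t⟩ := b
  simp only [Atom.map, Atom.mk.injEq] at h
  obtain ⟨rfl, h⟩ := h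
  exact ⟨rfl, fun i => congrFun (eq_of_heq h) i⟩

lemma Term.ground_rename (τ : V → C) (π : Equiv.Perm V) (t : Term V C) :
    (t.rename π).ground τ = t.ground (τ ∘ π) := by
  cases t <;> rfl

lemma Term.rename_rename (π π' : Equiv.Perm V) (t : Term V C) :
    (t.rename π).rename π' = t.rename (π' * π) := by
  cases t <;> rfl

lemma Term.rename_one (t : Term V C) : t.rename 1 = t := by
  cases t <;> rfl

lemma Atom.rename_rename (π π' : Equiv.Perm V) (a : Atom ar (Term V C)) :
    (a.map (Term.rename π)).map (Term.rename π') = a.map (Term.rename (π' * π)) := by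
  rw [Atom.map_map]
  exact Atom.map_congr fun i => Term.rename_rename _ _ _

lemma Atom.rename_one (a : Atom ar (Term V C)) : a.map (Term.rename 1) = a := by
  obtain ⟨p, s⟩ := a
  simp only [Atom.map, Term.rename_one]

lemma Adornment.rename_rename (π π' : Equiv.Perm V) (ρ : Adornment ar V C) :
    (ρ.rename π).rename π' = ρ.rename (π' * π) := by
  classical
  simp only [Adornment.rename, Atom.rename_rename, Finset.image_image]
  congr 1
  refine Finset.image_congr fun a _ => ?_
  simp only [Function.comp, Atom.map_map]
  refine Atom.map_congr fun i => ?_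
  simp only [Function.comp, Option.map_map]
  congr 1
  funext t
  exact Term.rename_rename _ _ _

lemma Adornment.rename_one (ρ : Adornment ar V C) : ρ.rename 1 = ρ := by
  classical
  obtain ⟨h, B⟩ := ρ
  have : (fun a : Atom ar (Option (Term V C)) => a.map (Option.map (Term.rename 1))) = id := by
    funext a
    obtain ⟨p, s⟩ := a
    have : (Term.rename (1 : Equiv.Perm V) : Term V C → Term V C) = id :=
      funext Term.rename_one
    simp [Atom.map, this]
  simp only [Adornment.rename, Atom.rename_one, this, Finset.image_id]

lemma AdornedAtom.rename_rename (π π' : Equiv.Perm V) (A : AdornedAtom ar V C) :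
    (A.rename π).rename π' = A.rename (π' * π) := by
  simp only [AdornedAtom.rename, Atom.rename_rename, Adornment.rename_rename]

lemma AdornedAtom.rename_one (A : AdornedAtom ar V C) : A.rename 1 = A := by
  simp only [AdornedAtom.rename, Atom.rename_one, Adornment.rename_one]

lemma Atom.mem_vars_rename {π : Equiv.Perm V} {a : Atom ar (Term V C)} {x : V} :
    x ∈ (a.map (Term.rename π)).vars ↔ π.symm x ∈ a.vars := by
  refine exists_congr fun i => ?_
  change (a.args i).rename π = _ ↔ _
  cases a.args i <;> simp [Term.rename, Equiv.eq_symm_apply]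

lemma Atom.mem_namedVars_rename {π : Equiv.Perm V} {a : Atom ar (Option (Term V C))} {x : V} :
    x ∈ (a.map (Option.map (Term.rename π))).namedVars ↔ π.symm x ∈ a.namedVars := by
  refine exists_congr fun i => ?_
  change (a.args i).map (Term.rename π) = _ ↔ _
  rcases a.args i with _ | (y | c) <;> simp [Term.rename, Equiv.eq_symm_apply]

lemma Adornment.mem_body_rename {π : Equiv.Perm V} {ρ : Adornment ar V C}
    {b : Atom ar (Option (Term V C))} :
    b ∈ (ρ.rename π).body ↔ ∃ a ∈ ρ.body, a.map (Option.map (Term.rename π)) = b := by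
  classical
  simp [Adornment.rename]

lemma AdornedAtom.mem_vars_rename {π : Equiv.Perm V} {A : AdornedAtom ar V C} {x : V} :
    x ∈ (A.rename π).vars ↔ π.symm x ∈ A.vars := by
  refine or_congr Atom.mem_vars_rename (or_congr Atom.mem_vars_rename ?_)
  constructor
  · rintro ⟨b, hb, hx⟩
    obtain ⟨a, ha, rfl⟩ := Adornment.mem_body_rename.1 hb
    exact ⟨a, ha, Atom.mem_namedVars_rename.1 hx⟩
  · rintro ⟨a, ha, hx⟩
    exact ⟨_, Adornment.mem_body_rename.2 ⟨a, ha, rfl⟩, Atom.mem_namedVars_rename.2 hx⟩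

lemma Atom.finite_vars (a : Atom ar (Term V C)) : a.vars.Finite := by
  refine (Set.finite_range fun i => a.args i).preimage (f := Term.var)
    (fun _ _ _ _ h => Term.var.inj h) |>.subset ?_
  rintro x ⟨i, hi⟩
  exact ⟨i, hi⟩

lemma Atom.finite_namedVars (a : Atom ar (Option (Term V C))) : a.namedVars.Finite := by
  refine (Set.finite_range fun i => a.args i).preimage (f := fun x => some (Term.var x))
    (fun _ _ _ _ h => Term.var.inj (Option.some.inj h)) |>.subset ?_
  rintro x ⟨i, hi⟩
  exact ⟨i, hi⟩

lemma Rule.finite_vars (R : Rule ar V C) : R.vars.Finite := by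
  refine (R.head.finite_vars.union
    ((List.finite_toSet R.body).biUnion fun a _ => a.finite_vars)).subset ?_
  rintro x (hx | ⟨a, ha, hx⟩)
  · exact Or.inl hx
  · exact Or.inr (Set.mem_biUnion (x := a) ha hx)

lemma AdornedAtom.finite_vars (A : AdornedAtom ar V C) : A.vars.Finite := by
  refine (A.atom.finite_vars.union (A.adornment.head.finite_vars.union
    (A.adornment.body.finite_toSet.biUnion fun a _ => a.finite_namedVars))).subset ?_
  rintro x (hx | hx | ⟨a, ha, hx⟩)
  · exact Or.inl hx
  · exact Or.inr (Or.inl hx)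
  · exact Or.inr (Or.inr (Set.mem_biUnion (x := a) ha hx))

end Substitutions

/-! ### Permutations that extend injections of finite sets. -/

section Renaming

/-- An injection defined on a finite set extends to a permutation. -/
lemma exists_perm_extending {V : Type*} {X : Set V} (hX : X.Finite) {f : V → V}
    (hf : Set.InjOn f X) : ∃ π : Equiv.Perm V, ∀ x ∈ X, π x = f x := by
  classical
  have hY : (X ∪ f '' X).Finite := hX.union (hX.image f)
  let p : V → Prop := fun y => y ∈ X ∪ f '' X
  have : Fintype {y // p y} := hY.fintype
  let e₀ : {y : {y // p y} // (y : V) ∈ X} → {y : {y // p y} // (y : V) ∈ f '' X} :=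
    fun y => ⟨⟨f y, Or.inr ⟨_, y.2, rfl⟩⟩, ⟨_, y.2, rfl⟩⟩
  have he₀ : Function.Bijective e₀ := by
    constructor
    · intro y y' h
      have h' : f y = f y' := Subtype.ext_iff.1 (Subtype.ext_iff.1 h)
      exact Subtype.ext (Subtype.ext (hf y.2 y'.2 h'))
    · rintro ⟨⟨z, hz⟩, x, hx, hxz⟩
      exact ⟨⟨⟨x, Or.inl hx⟩, hx⟩, Subtype.ext (Subtype.ext hxz)⟩
  let e := Equiv.ofBijective e₀ he₀
  refine ⟨Equiv.Perm.ofSubtype e.extendSubtype, fun x hx => ?_⟩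
  have hpx : p x := Or.inl hx
  rw [Equiv.Perm.ofSubtype_apply_of_mem _ hpx, Equiv.extendSubtype_apply_of_mem e ⟨x, hpx⟩ hx]
  rfl

/-- Finitely many permutations that move a finite set away from itself and to pairwise disjoint
sets. -/
lemma exists_perms_apart {V : Type*} [Infinite V] {Z : Set V} (hZ : Z.Finite) (n : ℕ) :
    ∃ π : Fin n → Equiv.Perm V, (∀ i, ∀ x ∈ Z, π i x ∉ Z) ∧
      ∀ i j, i ≠ j → ∀ x ∈ Z, ∀ y ∈ Z, π i x ≠ π j y := by
  classical
  have : Fintype Z := hZ.fintype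
  have hinf : Infinite ↥(Zᶜ) := hZ.infinite_compl.to_subtype
  let f : Fin n × Z ↪ ↥(Zᶜ) := ((Fintype.equivFin (Fin n × Z)).toEmbedding.trans
    Fin.valEmbedding).trans (Infinite.natEmbedding _)
  have hπ : ∀ i, ∃ π : Equiv.Perm V, ∀ x ∈ Z,
      π x = if h : x ∈ Z then (f (i, ⟨x, h⟩) : V) else x := by
    intro i
    refine exists_perm_extending hZ fun x hx y hy h => ?_
    simp only [dif_pos hx, dif_pos hy] at h
    simpa using f.injective (Subtype.ext h)
  choose π hπ using hπ
  refine ⟨π, fun i x hx => ?_, fun i j hij x hx y hy h => hij ?_⟩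
  · rw [hπ i x hx, dif_pos hx]
    exact (f _).2
  · rw [hπ i x hx, hπ j y hy, dif_pos hx, dif_pos hy] at h
    exact congrArg Prod.fst (f.injective (Subtype.ext h))

/-- A set with at most as many elements as a finite set `W` can be moved into `W`. -/
lemma exists_perm_into {V : Type*} {X W : Finset V} (h : X.card ≤ W.card) :
    ∃ π : Equiv.Perm V, ∀ x ∈ X, π x ∈ W := by
  classical
  obtain ⟨f⟩ : Nonempty (X ↪ W) := Function.Embedding.nonempty_of_card_le (by simpa using h)
  obtain ⟨π, hπ⟩ := exists_perm_extending (X := (X : Set V)) X.finite_toSet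
    (f := fun x => if h : x ∈ X then (f ⟨x, h⟩ : V) else x) <| by
      intro x hx y hy h
      rw [Finset.mem_coe] at hx hy
      simp only [dif_pos hx, dif_pos hy] at h
      simpa using f.injective (Subtype.ext h)
  refine ⟨π, fun x hx => ?_⟩
  rw [hπ x hx, dif_pos hx]
  exact (f _).2

end Renaming

/-! ### Most general unifiers without function symbols. -/

section Unification

variable {P : Type u} {ar : P → ℕ} {V : Type v} {C : Type w}

/-- The constants of an atom. -/
def Atom.consts (a : Atom ar (Term V C)) : Set C := {c | ∃ i, a.args i = .const c}

/-- Two terms that every unifier of `S` identifies. -/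
def unifierSetoid (S : Set (Atom ar (Term V C) × Atom ar (Term V C))) : Setoid (Term V C) where
  r s t := ∀ τ, IsUnifier S τ → s.subst τ = t.subst τ
  iseqv := ⟨fun _ _ _ => rfl, fun h τ hτ => (h τ hτ).symm,
    fun h h' τ hτ => (h τ hτ).trans (h' τ hτ)⟩

/-- With no function symbols there is no occurs check. Terms that all unifiers identify form
classes, and the given unifier shows that a class contains at most one constant. Sending each
variable to a representative of its class, the constant if there is one, gives a unifier, and every
unifier `τ'` factors through it via `τ'` itself. -/
lemma exists_isMGU {S : Set (Atom ar (Term V C) × Atom ar (Term V C))} {τ : V → Term V C}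
    (hτ : IsUnifier S τ) : ∃ σ, IsMGU S σ := by
  classical
  let r := unifierSetoid S
  let rep : Term V C → Term V C := fun t =>
    if h : ∃ c, r t (.const c) then .const h.choose else (Quotient.mk r t).out
  have hrep : ∀ t, r (rep t) t := by
    intro t
    by_cases h : ∃ c, r t (.const c)
    · simp only [rep, dif_pos h]
      exact r.symm h.choose_spec
    · simp only [rep, dif_neg h]
      exact Quotient.mk_out (s := r) t
  have hcongr : ∀ s t, r s t → rep s = rep t := by
    intro s t hst
    by_cases h : ∃ c, r t (.const c)
    · have h' : ∃ c, r s (.const c) := ⟨_, r.trans hst h.choose_spec⟩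
      simp only [rep, dif_pos h, dif_pos h']
      exact r.trans (r.symm h'.choose_spec) (r.trans hst h.choose_spec) τ hτ
    · have h' : ¬ ∃ c, r s (.const c) := fun ⟨c, hc⟩ => h ⟨c, r.trans (r.symm hst) hc⟩
      simp only [rep, dif_neg h, dif_neg h']
      rw [Quotient.sound (s := r) hst]
  have hsubst : ∀ t : Term V C, t.subst (fun x => rep (.var x)) = rep t := by
    rintro (x | c)
    · rfl
    · have h : ∃ c', r (.const c) (.const c') := ⟨c, r.refl _⟩
      simp only [rep, dif_pos h]
      exact h.choose_spec τ hτ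
  refine ⟨fun x => rep (.var x), ?_, fun τ' hτ' => ⟨τ', fun x => hrep (.var x) τ' hτ'⟩⟩
  rintro ⟨⟨p, s⟩, ⟨q, t⟩⟩ hp
  obtain ⟨hpq, -⟩ := Atom.mk.inj (hτ _ hp)
  change p = q at hpq
  subst hpq
  have key : ∀ i, r (s i) (t i) := by
    intro i τ' hτ'
    exact congrFun (eq_of_heq (Atom.mk.inj (hτ' _ hp)).2) i
  simp only [Atom.map, hsubst]
  congr 1
  funext i
  exact hcongr _ _ (key i)

/-- A most general unifier introduces no constants of its own. -/
lemma IsMGU.const_mem {S : Set (Atom ar (Term V C) × Atom ar (Term V C))} {σ : V → Term V C}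
    (hσ : IsMGU S σ) {x : V} {c : C} (hx : σ x = .const c) :
    ∃ p ∈ S, c ∈ p.1.consts ∨ c ∈ p.2.consts := by
  classical
  by_contra hcon
  push Not at hcon
  -- If `c` did not occur in `S`, turning it into a variable after `σ` would give another unifier,
  -- but no instantiation of `σ` maps the constant `c` to a variable.
  let f : Term V C → Term V C := fun t => if t = .const c then .var x else t
  have hf : ∀ a : Atom ar (Term V C), c ∉ a.consts →
      a.map (Term.subst (f ∘ σ)) = (a.map (Term.subst σ)).map f := by
    intro a ha
    refine Atom.map_congr (g := f ∘ Term.subst σ) fun i => ?_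
    rcases h : a.args i with y | d
    · rfl
    · have : d ≠ c := by
        rintro rfl
        exact ha ⟨i, h⟩
      simp [Term.subst, f, this]
  obtain ⟨θ, hθ⟩ := hσ.2 (f ∘ σ) fun p hp => by
    rw [hf _ (hcon p hp).1, hf _ (hcon p hp).2, hσ.1 p hp]
  have := hθ x
  simp [hx, Term.subst, f] at this

end Unification

/-! ### Relaxation and the invariants of constructed rules. -/

section Invariants

variable {P : Type u} {ar : P → ℕ} {V : Type v} {C : Type w}

/-- A property that passes from the rules used in a construction to the constructed rule holds for
all rules in a program that the algorithm reaches. -/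
lemma forall_mem_of_reachable {g : Adornment ar V C → Adornment ar V C}
    {h : AdornedRule ar V C → AdornedProgram ar V C → Prop} {prog : Program ar V C}
    {I : AdornedRule ar V C → Prop}
    (hI : ∀ adn R', (∀ c ∈ adn, I c) → Constructs g prog adn R' → I R')
    {adn : AdornedProgram ar V C}
    (hadn : Relation.ReflTransGen (AlgorithmStep g h prog) ∅ adn) : ∀ R ∈ adn, I R := by
  classical
  induction hadn with
  | refl => simp
  | tail _ hstep ih =>
    obtain ⟨R', hR', -, rfl⟩ := hstep
    intro R hR
    rcases Finset.mem_insert.1 hR with rfl | hR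
    · exact hI _ _ ih hR'
    · exact ih R hR

lemma Program.mem_idbBody {prog : Program ar V C} {R : Rule ar V C} {a : Atom ar (Term V C)} :
    a ∈ prog.idbBody R ↔ a ∈ R.body ∧ prog.IsIDB a.pred := by
  classical
  simp [Program.idbBody]

lemma Program.mem_edbBody {prog : Program ar V C} {R : Rule ar V C} {a : Atom ar (Term V C)} :
    a ∈ prog.edbBody R ↔ a ∈ R.body ∧ ¬ prog.IsIDB a.pred := by
  classical
  simp [Program.edbBody]

lemma Program.pred_mem_edbs {prog : Program ar V C} {R : Rule ar V C} (hR : R ∈ prog)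
    {a : Atom ar (Term V C)} (ha : a ∈ prog.edbBody R) : a.pred ∈ prog.edbs :=
  ⟨⟨R, hR, Or.inr ⟨a, (mem_edbBody.1 ha).1, rfl⟩⟩, (mem_edbBody.1 ha).2⟩

lemma mem_body_inlinedAdornment {prog : Program ar V C} {R : Rule ar V C}
    {A : Fin (prog.idbBody R).length → AdornedAtom ar V C} {σ : V → Term V C}
    {b : Atom ar (Option (Term V C))} :
    b ∈ (inlinedAdornment prog R A σ).body ↔
      (∃ i, ∃ a ∈ (A i).adornment.body, a.map (Option.map (Term.subst σ)) = b) ∨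
        ∃ a ∈ prog.edbBody R, a.map (fun t => some (Term.subst σ t)) = b := by
  classical
  simp [inlinedAdornment]

lemma mem_body_gOut {ρ : Adornment ar V C} {a : Atom ar (Option (Term V C))} :
    a ∈ (gOut ρ).body ↔ (∃ b ∈ ρ.body, b.map (maskArg ρ.head.vars) = a) ∧
      (∃ i, a.args i ≠ none) ∧ ∀ b ∈ ρ.body, LessRestrictive a (b.map (maskArg ρ.head.vars)) →
        b.map (maskArg ρ.head.vars) = a := by
  classical
  simp [gOut]

lemma maskArg_eq_some {O : Set V} {s : Option (Term V C)} {t : Term V C} :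
    maskArg O s = some t ↔ s = some t ∧ ∃ x ∈ O, t = .var x := by
  classical
  rcases s with _ | (x | c)
  · simp [maskArg]
  · simp only [maskArg]
    split_ifs with h
    · constructor
      · rintro h'
        exact ⟨h', x, h, (Option.some.inj h').symm⟩
      · exact fun h' => h'.1
    · simp only [Option.some.injEq, false_iff, not_and, not_exists]
      rintro rfl y hy h'
      exact h (by rw [Term.var.inj h']; exact hy)
  · simp only [maskArg, reduceCtorEq, Option.some.injEq, false_iff, not_and, not_exists]
    rintro rfl y - h'
    cases h'

lemma LessRestrictive.refl (a : Atom ar (Option (Term V C))) : LessRestrictive a a :=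
  ⟨a.pred, a.args, a.args, rfl, rfl, fun _ => Or.inl rfl⟩

lemma LessRestrictive.trans {a b c : Atom ar (Option (Term V C))} (hab : LessRestrictive a b)
    (hbc : LessRestrictive b c) : LessRestrictive a c := by
  obtain ⟨p, s, t, rfl, rfl, h⟩ := hab
  obtain ⟨q, t', r, hb, rfl, h'⟩ := hbc
  obtain ⟨hpq, ht⟩ := Atom.mk.inj hb
  subst hpq
  obtain rfl := eq_of_heq ht
  refine ⟨p, s, r, rfl, rfl, fun i => ?_⟩
  rcases h i with h1 | h1
  · rw [h1]
    exact h' i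
  · exact Or.inr h1

open Classical in
/-- The number of arguments of an atom that are not underscores. -/
noncomputable def Atom.numNamed (a : Atom ar (Option (Term V C))) : ℕ :=
  (Finset.univ.filter fun i => a.args i ≠ none).card

/-- A strictly more restrictive atom has more named arguments, so an atom with the largest such
number is maximal and survives relaxation. -/
lemma LessRestrictive.eq_of_numNamed_le {a b : Atom ar (Option (Term V C))}
    (hab : LessRestrictive a b) (h : b.numNamed ≤ a.numNamed) : b = a := by
  classical
  obtain ⟨p, s, t, rfl, rfl, hst⟩ := hab
  have hsub : (Finset.univ.filter fun i => s i ≠ none) ⊆ Finset.univ.filter fun i => t i ≠ none := by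
    intro i hi
    rw [Finset.mem_filter] at hi ⊢
    exact ⟨Finset.mem_univ _, by rw [← (hst i).resolve_right hi.2]; exact hi.2⟩
  have heq := Finset.eq_of_subset_of_card_le hsub h
  congr 1
  funext i
  rcases hst i with h1 | h1
  · exact h1.symm
  · have : i ∉ Finset.univ.filter fun i => t i ≠ none := by
      rw [← heq]
      simp [h1]
    simp only [Finset.mem_filter, Finset.mem_univ, true_and, not_not] at this
    rw [h1, this]

lemma LessRestrictive.namedVars_subset {a b : Atom ar (Option (Term V C))}
    (hab : LessRestrictive a b) : a.namedVars ⊆ b.namedVars := by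
  obtain ⟨p, s, t, rfl, rfl, hst⟩ := hab
  rintro x ⟨i, hi⟩
  refine ⟨i, ?_⟩
  rcases hst i with h | h
  · exact h.symm.trans hi
  · exact absurd (hi.symm.trans h) (by simp)

/-- Every head variable of the adornment occurs in its body. -/
def Adornment.Covered (ρ : Adornment ar V C) : Prop :=
  ∀ x ∈ ρ.head.vars, ∃ a ∈ ρ.body, x ∈ a.namedVars

/-- Masking spares head variables, and an atom is deleted for being less restrictive only in favour
of one that contains its named variables. A maximal atom above the masked `a` is kept and still
contains `x`. -/
lemma Adornment.Covered.gOut {ρ : Adornment ar V C} (hρ : ρ.Covered) :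
    (Datalog.gOut ρ).Covered := by
  classical
  intro x hx
  obtain ⟨a, ha, i, hi⟩ := hρ x hx
  let m := Atom.map (ar := ar) (maskArg (C := C) ρ.head.vars)
  obtain ⟨b, hb, hmax⟩ := (ρ.body.filter fun b => LessRestrictive (m a) (m b)).exists_max_image
    (fun b => (m b).numNamed) ⟨a, by simpa using ⟨ha, LessRestrictive.refl _⟩⟩
  rw [Finset.mem_filter] at hb
  have hxa : x ∈ (m a).namedVars := ⟨i, maskArg_eq_some.2 ⟨hi, x, hx, rfl⟩⟩
  have hxb := hb.2.namedVars_subset hxa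
  refine ⟨m b, mem_body_gOut.2 ⟨⟨b, hb.1, rfl⟩, ?_, fun c hc hbc => ?_⟩, hxb⟩
  · obtain ⟨j, hj⟩ := hxb
    exact ⟨j, by simp [hj]⟩
  · exact hbc.eq_of_numNamed_le (hmax c (Finset.mem_filter.2 ⟨hc, hb.2.trans hbc⟩))

/-- The properties of the heads of all constructed rules. -/
structure AdornedAtom.WellFormed (prog : Program ar V C) (A : AdornedAtom ar V C) : Prop where
  head_eq : A.adornment.head = A.atom
  covered : A.adornment.Covered
  pred_mem : ∀ a ∈ A.adornment.body, a.pred ∈ prog.edbs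

lemma AdornedAtom.WellFormed.rename {prog : Program ar V C} {A : AdornedAtom ar V C}
    (hA : A.WellFormed prog) (π : Equiv.Perm V) : (A.rename π).WellFormed prog where
  head_eq := congrArg (Atom.map (Term.rename π)) hA.head_eq
  covered := by
    intro x hx
    obtain ⟨a, ha, hxa⟩ := hA.covered _ (Atom.mem_vars_rename.1 hx)
    exact ⟨_, Adornment.mem_body_rename.2 ⟨a, ha, rfl⟩, Atom.mem_namedVars_rename.2 hxa⟩
  pred_mem := by
    intro b hb
    obtain ⟨a, ha, rfl⟩ := Adornment.mem_body_rename.1 hb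
    exact hA.pred_mem a ha

lemma Term.subst_eq_var {σ : V → Term V C} {t : Term V C} {x : V} (h : t.subst σ = .var x) :
    ∃ y, t = .var y ∧ σ y = .var x := by
  cases t with
  | var y => exact ⟨y, rfl, h⟩
  | const c => cases h

/-- By safety, a head variable comes from a variable `y` of a body atom. An EDB atom is itself in
the adornment. For an IDB atom, unification matches the position of `y` with a head variable `z` of
the chosen rule, and the adornment of that rule covers `z`. -/
lemma covered_inlinedAdornment {prog : Program ar V C} {R : Rule ar V C} (hsafe : R.Safe)
    {A : Fin (prog.idbBody R).length → AdornedAtom ar V C} {σ : V → Term V C}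
    (hA : ∀ i, (A i).WellFormed prog)
    (hσ : IsUnifier (Set.range fun i => ((prog.idbBody R).get i, (A i).atom)) σ) :
    (inlinedAdornment prog R A σ).Covered := by
  rintro x ⟨i, hi⟩
  obtain ⟨y, hy, hyx⟩ := Term.subst_eq_var hi
  obtain ⟨a, ha, j, hj⟩ := hsafe y ⟨i, hy⟩
  by_cases hidb : prog.IsIDB a.pred
  · obtain ⟨k, rfl⟩ := List.mem_iff_get.1 (Program.mem_idbBody.2 ⟨ha, hidb⟩)
    obtain ⟨e, he⟩ := Atom.args_of_map_eq (hσ _ ⟨k, rfl⟩)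
    have hk := he j
    simp only [] at hk
    rw [hj] at hk
    obtain ⟨z, hz, hzx⟩ := Term.subst_eq_var (hk.symm.trans hyx)
    obtain ⟨b, hb, l, hl⟩ := (hA k).covered z (by rw [(hA k).head_eq]; exact ⟨_, hz⟩)
    refine ⟨_, mem_body_inlinedAdornment.2 (Or.inl ⟨k, b, hb, rfl⟩), l, ?_⟩
    change (b.args l).map _ = _
    rw [hl, Option.map_some, Term.subst, hzx]
  · refine ⟨_, mem_body_inlinedAdornment.2
      (Or.inr ⟨a, Program.mem_edbBody.2 ⟨ha, hidb⟩, rfl⟩), j, ?_⟩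
    change some ((a.args j).subst σ) = _
    rw [hj, Term.subst, hyx]

lemma wellFormed_of_reachable {h : AdornedRule ar V C → AdornedProgram ar V C → Prop}
    {prog : Program ar V C} (hsafe : prog.Safe) {adn : AdornedProgram ar V C}
    (hadn : Relation.ReflTransGen (AlgorithmStep gOut h prog) ∅ adn) :
    ∀ R ∈ adn, R.head.WellFormed prog := by
  refine forall_mem_of_reachable (fun adn R' ih hR' => ?_) hadn
  obtain ⟨R, hR, c, π, σ, hc, -, -, hσ, rfl⟩ := hR'
  have hA := fun i => (ih _ (hc i).1).rename (π i)
  refine ⟨rfl, (covered_inlinedAdornment (hsafe R hR) hA hσ.1).gOut, fun a ha => ?_⟩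
  obtain ⟨⟨b, hb, rfl⟩, -⟩ := mem_body_gOut.1 ha
  rcases mem_body_inlinedAdornment.1 hb with ⟨i, b', hb', rfl⟩ | ⟨b', hb', rfl⟩
  · exact (hA i).pred_mem b' hb'
  · exact Program.pred_mem_edbs hR hb'

end Invariants

/-! ### Derived facts are represented by adorned heads. -/

section Soundness

variable {P : Type u} {ar : P → ℕ} {V : Type v} {C : Type w}

/-- Some fact in `I` agrees with the instance of `a` under `τ`, except for underscores. -/
def Witnessed (I : Set (Atom ar C)) (τ : V → C) (a : Atom ar (Option (Term V C))) : Prop :=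
  ∃ u : Fin (ar a.pred) → C, (⟨a.pred, u⟩ : Atom ar C) ∈ I ∧
    ∀ i t, a.args i = some t → t.ground τ = u i

/-- The fact `f` is the instance of the adorned atom under `τ`, and the facts in `I` are as the
adornment requires. -/
structure AdornedAtom.Represents (I : Set (Atom ar C)) (τ : V → C) (A : AdornedAtom ar V C)
    (f : Atom ar C) : Prop where
  atom_eq : A.atom.map (Term.ground τ) = f
  witnessed : ∀ a ∈ A.adornment.body, Witnessed I τ a

lemma Term.ground_congr {τ τ' : V → C} {t : Term V C} (h : ∀ x, t = .var x → τ x = τ' x) :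
    t.ground τ = t.ground τ' := by
  cases t with
  | var x => exact h x rfl
  | const c => rfl

/-- Only the variables of `A` matter, so valuations of heads renamed apart can be glued into one. -/
lemma AdornedAtom.Represents.congr {I : Set (Atom ar C)} {τ τ' : V → C} {A : AdornedAtom ar V C}
    {f : Atom ar C} (hA : A.Represents I τ f) (h : ∀ x ∈ A.vars, τ x = τ' x) :
    A.Represents I τ' f where
  atom_eq := hA.atom_eq ▸ Atom.map_congr fun i =>
    (Term.ground_congr fun x hx => h x (Or.inl ⟨i, hx⟩)).symm
  witnessed := by
    intro a ha
    obtain ⟨u, hu, hau⟩ := hA.witnessed a ha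
    refine ⟨u, hu, fun i t hit => (hau i t hit) ▸ ?_⟩
    refine (Term.ground_congr fun x hx => h x (Or.inr (Or.inr ⟨a, ha, i, ?_⟩))).symm
    rw [hit, hx]

lemma AdornedAtom.Represents.rename {I : Set (Atom ar C)} {τ : V → C} {A : AdornedAtom ar V C}
    {f : Atom ar C} (hA : A.Represents I τ f) (π : Equiv.Perm V) :
    (A.rename π).Represents I (τ ∘ π.symm) f := by
  have hτ : ∀ t : Term V C, (t.rename π).ground (τ ∘ π.symm) = t.ground τ := by
    intro t
    rw [Term.ground_rename]
    congr 1
    funext x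
    simp
  refine ⟨?_, fun b hb => ?_⟩
  · rw [← hA.atom_eq]
    exact Atom.map_congr (a := A.atom) (f := Term.ground (τ ∘ π.symm) ∘ Term.rename π)
      fun i => hτ _
  · obtain ⟨a, ha, rfl⟩ := Adornment.mem_body_rename.1 hb
    obtain ⟨u, hu, hau⟩ := hA.witnessed a ha
    refine ⟨u, hu, fun i t hit => ?_⟩
    obtain ⟨t', ht', rfl⟩ := Option.map_eq_some_iff.1 hit
    rw [hτ]
    exact hau i t' ht'

lemma Witnessed.mask {I : Set (Atom ar C)} {τ : V → C} {a : Atom ar (Option (Term V C))}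
    (h : Witnessed I τ a) (O : Set V) : Witnessed I τ (a.map (maskArg O)) := by
  obtain ⟨u, hu, hau⟩ := h
  exact ⟨u, hu, fun i t hit => hau i t (maskArg_eq_some.1 hit).1⟩

/-- Functions on pairwise disjoint sets have a common extension. -/
lemma exists_common_extension {ι : Type*} {X : ι → Set V}
    (hX : ∀ i j, i ≠ j → Disjoint (X i) (X j)) {Y : Set V} (hY : ∀ i, Disjoint Y (X i))
    (τ : V → C) (τ' : ι → V → C) :
    ∃ τ'' : V → C, (∀ x ∈ Y, τ'' x = τ x) ∧ ∀ i, ∀ x ∈ X i, τ'' x = τ' i x := by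
  classical
  refine ⟨fun x => if h : ∃ i, x ∈ X i then τ' h.choose x else τ x, fun x hx => ?_,
    fun i x hx => ?_⟩
  · refine dif_neg ?_
    rintro ⟨i, hi⟩
    exact Set.disjoint_left.1 (hY i) hx hi
  · have h : ∃ i, x ∈ X i := ⟨i, hx⟩
    have : h.choose = i := by
      by_contra hne
      exact Set.disjoint_left.1 (hX _ _ hne) h.choose_spec hx
    exact (dif_pos h).trans (by rw [this])

/-- Any choice of rules for the body atoms of a rule can be renamed apart. -/
lemma exists_renaming_apart [Infinite V] (R : Rule ar V C) {n : ℕ}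
    (A : Fin n → AdornedAtom ar V C) :
    ∃ π : Fin n → Equiv.Perm V, (∀ i, Disjoint R.vars ((A i).rename (π i)).vars) ∧
      ∀ i j, i ≠ j → Disjoint ((A i).rename (π i)).vars ((A j).rename (π j)).vars := by
  have hZ : (R.vars ∪ ⋃ i, (A i).vars).Finite :=
    R.finite_vars.union (Set.finite_iUnion fun i => (A i).finite_vars)
  have hAZ : ∀ i x, x ∈ (A i).vars → x ∈ R.vars ∪ ⋃ i, (A i).vars :=
    fun i x hx => Or.inr (Set.mem_iUnion.2 ⟨i, hx⟩)
  obtain ⟨π, h1, h2⟩ := exists_perms_apart hZ n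
  refine ⟨π, fun i => Set.disjoint_left.2 fun x hx hx' => ?_,
    fun i j hij => Set.disjoint_left.2 fun x hx hx' => ?_⟩
  · refine h1 i _ (hAZ i _ (AdornedAtom.mem_vars_rename.1 hx')) ?_
    rw [Equiv.apply_symm_apply]
    exact Or.inl hx
  · refine h2 i j hij _ (hAZ i _ (AdornedAtom.mem_vars_rename.1 hx)) _
      (hAZ j _ (AdornedAtom.mem_vars_rename.1 hx')) ?_
    simp

/-- A ground unifier factors through a most general unifier. -/
lemma IsMGU.exists_ground {S : Set (Atom ar (Term V C) × Atom ar (Term V C))} {σ : V → Term V C}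
    (hσ : IsMGU S σ) {τ : V → C} (hτ : IsUnifier S fun x => .const (τ x)) :
    ∃ τ' : V → C, ∀ t : Term V C, (t.subst σ).ground τ' = t.ground τ := by
  obtain ⟨θ, hθ⟩ := hσ.2 _ hτ
  -- The default `τ x` is never used: if `σ x` is a variable `y`, then `θ y` is the constant `τ x`.
  refine ⟨fun x => match θ x with
    | .const c => c
    | .var _ => τ x, ?_⟩
  rintro (x | c)
  · have := hθ x
    cases hx : σ x with
    | var y =>
      simp only [hx, Term.subst] at this
      simp [Term.subst, hx, Term.ground, this]
    | const c =>
      simp only [hx, Term.subst, Term.const.injEq] at this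
      simp [Term.subst, hx, Term.ground, this]
  · rfl

lemma isUnifier_const {S : Set (Atom ar (Term V C) × Atom ar (Term V C))} {τ : V → C}
    (h : ∀ p ∈ S, p.1.map (Term.ground τ) = p.2.map (Term.ground τ)) :
    IsUnifier S fun x => .const (τ x) := by
  have key : ∀ a : Atom ar (Term V C), a.map (Term.subst fun x => .const (τ x)) =
      (a.map (Term.ground τ)).map .const := by
    intro a
    refine Atom.map_congr (g := Term.const ∘ Term.ground τ) fun i => ?_
    cases a.args i <;> rfl
  intro p hp
  rw [key, key, h p hp]

/-- Every derived fact on an IDB predicate is represented by the head of a rule in the output. -/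
theorem exists_represents [Infinite V] {prog : Program ar V C} {adn : AdornedProgram ar V C}
    (hadn : ∀ R', Constructs gOut prog adn R' → hEq R' adn) (D : Set (Atom ar C)) {f : Atom ar C}
    (hf : f ∈ OrderHom.lfp (prog.immediateConsequence D)) (hidb : prog.IsIDB f.pred) :
    ∃ R ∈ adn, ∃ τ, R.head.Represents (OrderHom.lfp (prog.immediateConsequence D)) τ f := by
  set I := OrderHom.lfp (prog.immediateConsequence D) with hI
  -- Fixpoint induction: `S` is closed under the consequence operator. It is cut down to `I` so that
  -- the EDB body facts of a rule can serve as witnesses.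
  let S : Set (Atom ar C) :=
    {f | f ∈ I ∧ (prog.IsIDB f.pred → ∃ R ∈ adn, ∃ τ, R.head.Represents I τ f)}
  suffices hS : prog.immediateConsequence D S ≤ S from
    (OrderHom.lfp_le _ hS hf).2 hidb
  intro f hf
  have hfI : f ∈ I := by
    rw [hI, ← OrderHom.map_lfp]
    exact (prog.immediateConsequence D).monotone (fun _ h => h.1 : S ≤ I) hf
  refine ⟨hfI, fun hidb => ?_⟩
  rcases hf with hf | ⟨R, hR, τ, hbody, rfl⟩
  · exact absurd hidb hf.2.2
  have hmem := fun i : Fin (prog.idbBody R).length =>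
    Program.mem_idbBody.1 (List.get_mem (prog.idbBody R) i)
  have hrep := fun i => (hbody _ (hmem i).1).2 (hmem i).2
  choose c hc τ' hτ' using hrep
  obtain ⟨π, hπ1, hπ2⟩ := exists_renaming_apart R fun i => (c i).head
  obtain ⟨τ'', hτR, hτA⟩ := exists_common_extension hπ2 hπ1 τ fun i => τ' i ∘ (π i).symm
  have hA : ∀ i, ((c i).head.rename (π i)).Represents I τ''
      (((prog.idbBody R).get i).map (Term.ground τ)) := fun i =>
    ((hτ' i).rename (π i)).congr fun x hx => (hτA i x hx).symm
  have hground : ∀ a ∈ R.body, a.map (Term.ground τ'') = a.map (Term.ground τ) := fun a ha =>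
    Atom.map_congr fun i => Term.ground_congr fun x hx => hτR x (Or.inr ⟨a, ha, i, hx⟩)
  -- The glued valuation sends each IDB body atom and its renamed head to the same fact, so it is a
  -- ground unifier; hence a most general one exists and `τ''` factors through it.
  have hunif : IsUnifier (Set.range fun i =>
      ((prog.idbBody R).get i, ((c i).head.rename (π i)).atom)) fun x => .const (τ'' x) := by
    refine isUnifier_const ?_
    rintro _ ⟨i, rfl⟩
    rw [(hA i).atom_eq]
    exact hground _ (hmem i).1
  obtain ⟨σ, hσ⟩ := exists_isMGU hunif
  obtain ⟨τ₀, hτ₀⟩ := hσ.exists_ground hunif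
  -- The output is saturated, so it contains the rule just constructed up to a renaming `π'`, which
  -- the valuation has to undo.
  obtain ⟨R'', hR'', π', hπ', -⟩ := hadn _ ⟨R, hR, c, π, σ, fun i => ⟨hc i, by
    have := congrArg Atom.pred (hτ' i).atom_eq
    exact this⟩, hπ1, hπ2, hσ, rfl⟩
  refine ⟨R'', hR'', τ₀ ∘ π'.symm, hπ' ▸ AdornedAtom.Represents.rename ⟨?_, fun a ha => ?_⟩ π'⟩
  · rw [Atom.map_map]
    refine Atom.map_congr fun i => (hτ₀ _).trans ?_
    exact Term.ground_congr fun x hx => hτR x (Or.inl ⟨i, hx⟩)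
  · obtain ⟨⟨b, hb, rfl⟩, -⟩ := mem_body_gOut.1 ha
    refine Witnessed.mask ?_ _
    rcases mem_body_inlinedAdornment.1 hb with ⟨i, b', hb', rfl⟩ | ⟨b', hb', rfl⟩
    · obtain ⟨u, hu, hbu⟩ := (hA i).witnessed b' hb'
      refine ⟨u, hu, fun j t hjt => ?_⟩
      obtain ⟨t', ht', rfl⟩ := Option.map_eq_some_iff.1 hjt
      rw [hτ₀]
      exact hbu j t' ht'
    · have hb'R := (Program.mem_edbBody.1 hb').1
      refine ⟨fun j => (b'.args j).ground τ'', ?_, fun j t hjt => ?_⟩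
      · have := hground b' hb'R ▸ (hbody b' hb'R).1
        exact this
      · rw [← Option.some.inj hjt, hτ₀]

end Soundness

/-! ### The upper bound on the size of a relation. -/

section SizeBound

variable {P : Type u} {ar : P → ℕ} {V : Type v} {C : Type w}

/-- Coverage makes the set of cover sizes nonempty, so its infimum is attained rather than being the
default `0`. One body atom is then picked per hyperedge. -/
lemma Adornment.Covered.exists_cover {ρ : Adornment ar V C} (hρ : ρ.Covered) :
    ∃ B ⊆ ρ.body, B.card ≤ ρ.ew ∧ ∀ x ∈ ρ.head.vars, ∃ a ∈ B, x ∈ a.namedVars := by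
  classical
  have hne : {n | ∃ S : Finset (Set V), (S : Set (Set V)) ⊆ {e | ∃ a ∈ ρ.body, e = a.namedVars} ∧
      (∀ x ∈ ρ.head.vars, ∃ e ∈ S, x ∈ e) ∧ S.card = n}.Nonempty := by
    refine ⟨_, ρ.body.image Atom.namedVars, fun e he => ?_, fun x hx => ?_, rfl⟩
    · obtain ⟨a, ha, rfl⟩ := Finset.mem_image.1 (Finset.mem_coe.1 he)
      exact ⟨a, ha, rfl⟩
    · obtain ⟨a, ha, hxa⟩ := hρ x hx
      exact ⟨_, Finset.mem_image_of_mem _ ha, hxa⟩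
  obtain ⟨S, hS, hcov, hcard⟩ := Nat.sInf_mem hne
  choose f hf hfe using hS
  refine ⟨S.attach.image fun e => f e.2, fun a ha => ?_,
    (Finset.card_image_le.trans S.card_attach.le).trans hcard.le, fun x hx => ?_⟩
  · obtain ⟨e, -, rfl⟩ := Finset.mem_image.1 ha
    exact hf e.2
  · obtain ⟨e, he, hxe⟩ := hcov x hx
    exact ⟨f he, Finset.mem_image.2 ⟨⟨e, he⟩, Finset.mem_attach _ _, rfl⟩, hfe he ▸ hxe⟩

lemma Adornment.Covered.ew_le_card {ρ : Adornment ar V C} (hρ : ρ.Covered) :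
    ρ.ew ≤ ρ.body.card := by
  classical
  refine le_trans (Nat.sInf_le (m := (ρ.body.image Atom.namedVars).card)
    ⟨_, fun e he => ?_, fun x hx => ?_, rfl⟩) Finset.card_image_le
  · obtain ⟨a, ha, rfl⟩ := Finset.mem_image.1 (Finset.mem_coe.1 he)
    exact ⟨a, ha, rfl⟩
  · obtain ⟨a, ha, hxa⟩ := hρ x hx
    exact ⟨_, Finset.mem_image_of_mem _ ha, hxa⟩

/-- The arguments of a represented fact are taken from few EDB facts. -/
lemma AdornedAtom.Represents.exists_facts {prog : Program ar V C} {I : Set (Atom ar C)}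
    {τ : V → C} {A : AdornedAtom ar V C} {f : Atom ar C} (hA : A.Represents I τ f)
    (hwf : A.WellFormed prog) (hvar : ∀ i, ∃ x, A.atom.args i = .var x) :
    ∃ B : Finset (Atom ar C), B.card ≤ A.adornment.ew ∧ (∀ b ∈ B, b ∈ I ∧ b.pred ∈ prog.edbs) ∧
      ∀ i, ∃ b ∈ B, ∃ j, b.args j = f.args i := by
  classical
  obtain ⟨B, hB, hcard, hcov⟩ := hwf.covered.exists_cover
  obtain ⟨rfl, hw⟩ := hA
  choose u huI hu using hw
  refine ⟨B.attach.image fun a : {a // a ∈ B} => (⟨a.1.pred, u a (hB a.2)⟩ : Atom ar C),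
    (Finset.card_image_le.trans B.card_attach.le).trans hcard, fun b hb => ?_, fun i => ?_⟩
  · obtain ⟨a, -, rfl⟩ := Finset.mem_image.1 hb
    exact ⟨huI a (hB a.2), hwf.pred_mem a (hB a.2)⟩
  · obtain ⟨x, hx⟩ := hvar i
    obtain ⟨a, ha, j, hj⟩ := hcov x (by rw [hwf.head_eq]; exact ⟨i, hx⟩)
    refine ⟨_, Finset.mem_image_of_mem _ (Finset.mem_attach _ ⟨a, ha⟩), j,
      (hu a (hB ha) j _ hj).symm.trans ?_⟩
    change _ = (A.atom.args i).ground τ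
    rw [hx]

lemma Program.finite_edbs (prog : Program ar V C) : prog.edbs.Finite := by
  refine ((prog.finite_toSet.image fun R => R.head.pred).union
    (prog.finite_toSet.biUnion fun R _ => (List.finite_toSet R.body).image Atom.pred)).subset ?_
  rintro p ⟨⟨R, hR, rfl | ⟨a, ha, rfl⟩⟩, -⟩
  · exact Or.inl ⟨R, hR, rfl⟩
  · exact Or.inr (Set.mem_biUnion (x := R) hR ⟨a, ha, rfl⟩)

lemma Program.ar_le_ear (prog : Program ar V C) {e : P} (he : e ∈ prog.edbs) :
    ar e ≤ prog.ear :=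
  le_csSup (prog.finite_edbs.image ar).bddAbove ⟨e, he, rfl⟩

lemma Program.exists_finset_facts (prog : Program ar V C) (D : Set (Atom ar C)) {N : ℕ}
    (hN : ∀ e ∈ prog.edbs, (prog.relation D e).encard ≤ N) :
    ∃ F : Finset (Atom ar C), F.card ≤ prog.numEDBs * N ∧
      ∀ f ∈ OrderHom.lfp (prog.immediateConsequence D), f.pred ∈ prog.edbs → f ∈ F := by
  classical
  have hfin : ∀ e ∈ prog.edbs, ∃ T : Finset (Fin (ar e) → C),
      (T : Set _) = prog.relation D e ∧ T.card ≤ N := by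
    intro e he
    have h := Set.finite_of_encard_le_coe (hN e he)
    refine ⟨h.toFinset, h.coe_toFinset, ?_⟩
    have := hN e he
    rw [h.encard_eq_coe_toFinset_card] at this
    exact_mod_cast this
  choose! T hT hTN using hfin
  refine ⟨prog.finite_edbs.toFinset.biUnion fun e => (T e).image (Atom.mk e), ?_, fun f hf he => ?_⟩
  · rw [Program.numEDBs, Set.ncard_eq_toFinset_card _ prog.finite_edbs]
    refine Finset.card_biUnion_le_card_mul _ _ _ fun e he => Finset.card_image_le.trans ?_
    exact hTN e (by simpa using he)
  · refine Finset.mem_biUnion.2 ⟨f.pred, by simpa using he, Finset.mem_image.2 ⟨f.args, ?_, rfl⟩⟩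
    rw [← Finset.mem_coe, hT _ he]
    exact hf

lemma AdornedProgram.ew_le {adn : AdornedProgram ar V C} {n : ℕ}
    (h : ∀ R ∈ adn, R.head.adornment.ew ≤ n) (q : P) : adn.ew q ≤ n := by
  classical
  exact Finset.sup_le fun R hR => h R (Finset.mem_filter.1 hR).1

lemma AdornedProgram.le_ew {adn : AdornedProgram ar V C} {R : AdornedRule ar V C} (hR : R ∈ adn) :
    R.head.adornment.ew ≤ adn.ew R.head.atom.pred := by
  classical
  exact Finset.le_sup (f := fun R : AdornedRule ar V C => R.head.adornment.ew)
    (Finset.mem_filter.2 ⟨hR, rfl⟩)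

/-- The first size bound. -/
theorem encard_relation_le [Infinite V] {prog : Program ar V C} (hsafe : prog.Safe)
    {adn : AdornedProgram ar V C} (hadn : IsAlgorithmOutput gOut hEq prog adn) {q : P}
    (hq : prog.IsIDB q) (hpos : 0 < ar q) (hvar : adn.VariableHeads q) (D : Set (Atom ar C))
    {N : ℕ} (hN : ∀ e ∈ prog.edbs, (prog.relation D e).encard ≤ N) :
    (prog.relation D q).encard ≤
      (sizeBound (adn.ew q) (ar q) prog.numEDBs prog.ear N : ℕ) := by
  classical
  -- A constant is needed as the default value of `val`; without constants, positive arity makes the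
  -- relation empty.
  rcases isEmpty_or_nonempty C with hC | ⟨⟨c₀⟩⟩
  · have : prog.relation D q = ∅ := Set.eq_empty_of_forall_notMem fun t _ => hC.false (t ⟨0, hpos⟩)
    simp [this]
  obtain ⟨F, hFcard, hF⟩ := prog.exists_finset_facts D hN
  -- Positions beyond the arity of `f` get a dummy value, so that all positions can be drawn from
  -- the same `Fin prog.ear`.
  let val : Atom ar C → ℕ → C := fun f j => if h : j < ar f.pred then f.args ⟨j, h⟩ else c₀
  let Φ : (Fin (ar q) → F) × (Fin (ar q) → Fin prog.ear) → Fin (ar q) → C :=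
    fun x i => val (x.1 i) (x.2 i)
  have hsub : prog.relation D q ⊆ ↑(((Finset.univ.filter fun g : Fin (ar q) → F =>
      (Finset.univ.image g).card ≤ adn.ew q) ×ˢ Finset.univ).image Φ) := by
    intro t ht
    obtain ⟨R, hR, τ, hrep⟩ := exists_represents hadn.2 D ht hq
    have hpred : R.head.atom.pred = q := congrArg Atom.pred hrep.atom_eq
    obtain ⟨B, hBcard, hB, hBt⟩ := hrep.exists_facts (wellFormed_of_reachable hsafe hadn.1 R hR)
      (hvar R hR hpred)
    choose g hg j hj using hBt
    have hgF : ∀ i, g i ∈ F := fun i => hF _ (hB _ (hg i)).1 (hB _ (hg i)).2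
    have hear : ∀ i, (j i : ℕ) < prog.ear := fun i =>
      (j i).2.trans_le (prog.ar_le_ear (hB _ (hg i)).2)
    have hew : R.head.adornment.ew ≤ adn.ew q :=
      hpred ▸ AdornedProgram.le_ew hR
    rw [Finset.mem_coe, Finset.mem_image]
    refine ⟨(fun i => ⟨g i, hgF i⟩, fun i => ⟨j i, hear i⟩), ?_, ?_⟩
    · rw [Finset.mem_product, Finset.mem_filter]
      refine ⟨⟨Finset.mem_univ _, le_trans ?_ (hBcard.trans hew)⟩, Finset.mem_univ _⟩
      -- As facts, the values of `g` lie in the cover `B`, which bounds their number by the width.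
      rw [← Finset.card_image_of_injective _ Subtype.val_injective]
      refine Finset.card_le_card fun b hb => ?_
      simp only [Finset.mem_image, Finset.mem_univ, true_and, exists_exists_eq_and] at hb
      obtain ⟨i, rfl⟩ := hb
      exact hg i
    · funext i
      simp only [Φ, val, (j i).2, dif_pos]
      exact hj i
  refine (Set.encard_le_encard hsub).trans ?_
  rw [Set.encard_coe_eq_coe_finsetCard]
  exact_mod_cast Finset.card_image_le.trans
    (card_le_sizeBound F hpos _ _ _ _ (by simpa using hFcard))

end SizeBound

/-! ### Termination of the adornment algorithm. -/

section Termination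

variable {P : Type u} {ar : P → ℕ} {V : Type v} {C : Type w}

lemma forall₂_of_common_right {α β γ : Type*} {R : α → γ → Prop} {S : β → γ → Prop}
    {T : α → β → Prop} (hT : ∀ a b c, R a c → S b c → T a b) {l : List α} {l' : List β}
    {m : List γ} (h : List.Forall₂ R l m) (h' : List.Forall₂ S l' m) : List.Forall₂ T l l' := by
  induction h generalizing l' with
  | nil =>
    cases h'
    exact .nil
  | cons hd _ ih =>
    cases h' with
    | cons hd' tl' => exact .cons (hT _ _ _ hd hd') (ih tl')

lemma Atom.eq_rename_symm {π π' : Equiv.Perm V} {a b : Atom ar (Term V C)}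
    (h : a.map (Term.rename π) = b.map (Term.rename π')) :
    a.map (Term.rename (π'⁻¹ * π)) = b := by
  rw [← Atom.rename_rename, h, Atom.rename_rename, inv_mul_cancel, Atom.rename_one]

/-- Two rules that are identical to the same rule up to renaming are identical to each other up to
renaming. -/
lemma AdornedRule.SameUpToRenaming.of_common_right {R R' S : AdornedRule ar V C}
    (h : R.SameUpToRenaming S) (h' : R'.SameUpToRenaming S) : R.SameUpToRenaming R' := by
  obtain ⟨π, h1, h2, h3⟩ := h
  obtain ⟨π', h1', h2', h3'⟩ := h'
  refine ⟨π'⁻¹ * π, ?_, forall₂_of_common_right ?_ h2 h2', ?_⟩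
  · rw [← AdornedAtom.rename_rename, h1, ← h1', AdornedAtom.rename_rename, inv_mul_cancel,
      AdornedAtom.rename_one]
  · rintro A B D ⟨hA, ρ, hρ⟩ ⟨hB, ρ', hρ'⟩
    refine ⟨Atom.eq_rename_symm (hA.trans hB.symm), ρ'⁻¹ * ρ, ?_⟩
    rw [← Adornment.rename_rename, hρ, ← hρ', Adornment.rename_rename, inv_mul_cancel,
      Adornment.rename_one]
  · have hcomp : (Atom.map (ar := ar) (Term.rename (C := C) (π'⁻¹ * π))) =
        Atom.map (Term.rename π'⁻¹) ∘ Atom.map (Term.rename π) :=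
      funext fun a => (Atom.rename_rename _ _ a).symm
    have hid : (Atom.map (ar := ar) (Term.rename (C := C) π'⁻¹)) ∘ Atom.map (Term.rename π') = id :=
      funext fun a => by
        rw [Function.comp, Atom.rename_rename, inv_mul_cancel, Atom.rename_one, id]
    rw [hcomp, ← List.map_map, h3, ← h3', List.map_map, hid, List.map_id]

/-- The algorithm terminates if the constructed rules are, up to renaming, among finitely many. -/
lemma exists_output_of_representatives {g : Adornment ar V C → Adornment ar V C}
    {prog : Program ar V C} (F : Finset (AdornedRule ar V C))
    (hF : ∀ adn, Relation.ReflTransGen (AlgorithmStep g hEq prog) ∅ adn →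
      ∀ R, Constructs g prog adn R → ∃ S ∈ F, R.SameUpToRenaming S) :
    ∃ adn, IsAlgorithmOutput g hEq prog adn := by
  classical
  -- The termination measure: each added rule hits a representative that was missing, since two
  -- rules with a common representative would have been identified by `hEq`.
  let missing : AdornedProgram ar V C → Finset (AdornedRule ar V C) := fun adn =>
    F.filter fun S => ¬ ∃ R ∈ adn, AdornedRule.SameUpToRenaming R S
  suffices H : ∀ n adn, Relation.ReflTransGen (AlgorithmStep g hEq prog) ∅ adn →
      (missing adn).card = n → ∃ adn, IsAlgorithmOutput g hEq prog adn from
    H _ ∅ .refl rfl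
  intro n
  induction n using Nat.strong_induction_on with
  | _ n ih =>
    intro adn hadn hn
    by_cases hout : ∀ R, Constructs g prog adn R → hEq R adn
    · exact ⟨adn, hadn, hout⟩
    push Not at hout
    obtain ⟨R, hR, hnew⟩ := hout
    obtain ⟨S, hS, hRS⟩ := hF adn hadn R hR
    refine ih _ ?_ (insert R adn) (hadn.tail ⟨R, hR, hnew, rfl⟩) rfl
    rw [← hn]
    refine Finset.card_lt_card (Finset.ssubset_iff_of_subset ?_ |>.2 ⟨S, ?_, ?_⟩)
    · refine Finset.monotone_filter_right _ fun T _ hT => ?_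
      rintro ⟨R', hR', h⟩
      exact hT ⟨R', Finset.mem_insert_of_mem hR', h⟩
    · refine Finset.mem_filter.2 ⟨hS, ?_⟩
      rintro ⟨R', hR', h⟩
      exact hnew ⟨R', hR', hRS.of_common_right h⟩
    · intro hmem
      exact (Finset.mem_filter.1 hmem).2 ⟨R, Finset.mem_insert_self _ _, hRS⟩

/-- The terms over given variables and constants. -/
def termsOver (X : Set V) (K : Set C) : Set (Term V C) :=
  {t | (∃ x ∈ X, t = .var x) ∨ ∃ c ∈ K, t = .const c}

/-- The atoms over given predicates and arguments. -/
def atomsOver (Q : Set P) {T : Type*} (A : Set T) : Set (Atom ar T) :=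
  {a | a.pred ∈ Q ∧ ∀ i, a.args i ∈ A}

/-- The adornments over given predicates and terms. -/
def adornmentsOver (Q : Set P) (A : Set (Term V C)) : Set (Adornment ar V C) :=
  {ρ | ρ.head ∈ atomsOver Q A ∧ ∀ a ∈ ρ.body, a ∈ atomsOver Q (insert none (some '' A))}

lemma finite_termsOver {X : Set V} {K : Set C} (hX : X.Finite) (hK : K.Finite) :
    (termsOver X K).Finite := by
  refine ((hX.image Term.var).union (hK.image Term.const)).subset ?_
  rintro t (⟨x, hx, rfl⟩ | ⟨c, hc, rfl⟩)
  · exact Or.inl ⟨x, hx, rfl⟩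
  · exact Or.inr ⟨c, hc, rfl⟩

lemma finite_atomsOver {Q : Set P} {T : Type*} {A : Set T} (hQ : Q.Finite) (hA : A.Finite) :
    (atomsOver (ar := ar) Q A).Finite := by
  refine (hQ.biUnion fun p _ =>
    (Set.Finite.pi (fun _ : Fin (ar p) => hA)).image (Atom.mk p)).subset ?_
  rintro ⟨p, s⟩ ⟨hp, hs⟩
  exact Set.mem_biUnion (x := p) hp ⟨s, fun i _ => hs i, rfl⟩

lemma finite_adornmentsOver {Q : Set P} {A : Set (Term V C)} (hQ : Q.Finite) (hA : A.Finite) :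
    (adornmentsOver (ar := ar) Q A).Finite := by
  have hB := finite_atomsOver (ar := ar) hQ ((hA.image some).insert none)
  refine (((finite_atomsOver (ar := ar) hQ hA).prod hB.toFinset.powerset.finite_toSet).image
    fun x => (⟨x.1, x.2⟩ : Adornment ar V C)).subset ?_
  rintro ⟨h, B⟩ ⟨hh, hB'⟩
  refine ⟨(h, B), ⟨hh, ?_⟩, rfl⟩
  rw [Finset.mem_coe, Finset.mem_powerset]
  intro a ha
  exact hB.mem_toFinset.2 (hB' a ha)

lemma finite_listsOver {α : Type*} {s : Set α} (hs : s.Finite) (n : ℕ) :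
    {l : List α | l.length ≤ n ∧ ∀ x ∈ l, x ∈ s}.Finite := by
  have : Finite s := hs
  refine ((List.finite_length_le s n).image (List.map Subtype.val)).subset ?_
  rintro l ⟨hl, hls⟩
  lift l to List s using hls
  exact ⟨l, by simpa using hl, rfl⟩

/-- The adorned rules over given predicates and terms, with at most `L` body atoms of each kind. -/
def adornedRulesOver (Q : Set P) (A : Set (Term V C)) (L : ℕ) : Set (AdornedRule ar V C) :=
  {R | (R.head.atom ∈ atomsOver Q A ∧ R.head.adornment ∈ adornmentsOver Q A) ∧
    (R.idbBody.length ≤ L ∧ ∀ B ∈ R.idbBody,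
      B ∈ {B : AdornedAtom ar V C | B.atom ∈ atomsOver Q A ∧ B.adornment ∈ adornmentsOver Q A}) ∧
    (R.edbBody.length ≤ L ∧ ∀ a ∈ R.edbBody, a ∈ atomsOver Q A)}

lemma finite_adornedRulesOver {Q : Set P} {A : Set (Term V C)} (hQ : Q.Finite) (hA : A.Finite)
    (L : ℕ) : (adornedRulesOver (ar := ar) Q A L).Finite := by
  have hatoms := finite_atomsOver (ar := ar) hQ hA
  have hB : {B : AdornedAtom ar V C |
      B.atom ∈ atomsOver Q A ∧ B.adornment ∈ adornmentsOver Q A}.Finite := by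
    refine ((hatoms.prod (finite_adornmentsOver hQ hA)).image
      fun x => (⟨x.1, x.2⟩ : AdornedAtom ar V C)).subset ?_
    rintro ⟨a, ρ⟩ h
    exact ⟨(a, ρ), h, rfl⟩
  refine ((hB.prod ((finite_listsOver hB L).prod (finite_listsOver hatoms L))).image
    fun x => (⟨x.1, x.2.1, x.2.2⟩ : AdornedRule ar V C)).subset ?_
  rintro ⟨h, I, E⟩ hR
  exact ⟨(h, I, E), hR, rfl⟩

lemma Term.rename_mem_termsOver {X W : Set V} {K : Set C} {π : Equiv.Perm V}
    (hπ : ∀ x ∈ X, π x ∈ W) {t : Term V C} (ht : t ∈ termsOver X K) :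
    t.rename π ∈ termsOver W K := by
  rcases ht with ⟨x, hx, rfl⟩ | ⟨c, hc, rfl⟩
  · exact Or.inl ⟨π x, hπ x hx, rfl⟩
  · exact Or.inr ⟨c, hc, rfl⟩

lemma Atom.rename_mem_atomsOver {X W : Set V} {K : Set C} {π : Equiv.Perm V}
    (hπ : ∀ x ∈ X, π x ∈ W) {Q : Set P} {a : Atom ar (Term V C)}
    (ha : a ∈ atomsOver Q (termsOver X K)) :
    a.map (Term.rename π) ∈ atomsOver Q (termsOver W K) :=
  ⟨ha.1, fun i => Term.rename_mem_termsOver hπ (ha.2 i)⟩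

lemma Adornment.rename_mem_adornmentsOver {X W : Set V} {K : Set C} {π : Equiv.Perm V}
    (hπ : ∀ x ∈ X, π x ∈ W) {Q : Set P} {ρ : Adornment ar V C}
    (hρ : ρ ∈ adornmentsOver Q (termsOver X K)) :
    ρ.rename π ∈ adornmentsOver Q (termsOver W K) := by
  refine ⟨Atom.rename_mem_atomsOver hπ hρ.1, fun b hb => ?_⟩
  obtain ⟨a, ha, rfl⟩ := Adornment.mem_body_rename.1 hb
  refine ⟨(hρ.2 a ha).1, fun i => ?_⟩
  change (a.args i).map _ ∈ _
  rcases (hρ.2 a ha).2 i with h | ⟨t, ht, h⟩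
  · rw [h]
    exact Or.inl rfl
  · rw [← h]
    exact Or.inr ⟨_, Term.rename_mem_termsOver hπ ht, rfl⟩

/-- The rule uses given predicates and constants only, its size is bounded by `L`, and the number
of variables of the rule and of each body adornment is at most `M`. -/
structure AdornedRule.Bounded (Q : Set P) (K : Set C) (L M : ℕ) (R : AdornedRule ar V C) :
    Prop where
  exists_vars : ∃ X : Finset V, X.card ≤ M ∧ R.head.atom ∈ atomsOver Q (termsOver ↑X K) ∧
    R.head.adornment ∈ adornmentsOver Q (termsOver ↑X K) ∧
    (∀ B ∈ R.idbBody, B.atom ∈ atomsOver Q (termsOver ↑X K)) ∧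
    ∀ a ∈ R.edbBody, a ∈ atomsOver Q (termsOver ↑X K)
  adornment_mem : ∀ B ∈ R.idbBody, ∃ X : Finset V, X.card ≤ M ∧
    B.adornment ∈ adornmentsOver Q (termsOver ↑X K)
  length_idbBody_le : R.idbBody.length ≤ L
  length_edbBody_le : R.edbBody.length ≤ L

/-- All variables can be moved into one fixed set `W`. The body adornments are moved by permutations
of their own, which `SameUpToRenaming` permits; otherwise their variables would add to those of the
rule. -/
lemma AdornedRule.Bounded.exists_representative {Q : Set P} {K : Set C} {L M : ℕ}
    {R : AdornedRule ar V C} (hR : R.Bounded Q K L M) {W : Finset V} (hW : W.card = M) :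
    ∃ S ∈ adornedRulesOver Q (termsOver ↑W K) L, R.SameUpToRenaming S := by
  obtain ⟨X, hX, hhead, hadn, hidb, hedb⟩ := hR.exists_vars
  obtain ⟨π, hπ⟩ := exists_perm_into (hX.trans hW.ge)
  have h : ∀ B : AdornedAtom ar V C, ∃ ρ : Equiv.Perm V, B ∈ R.idbBody →
      B.adornment.rename ρ ∈ adornmentsOver Q (termsOver ↑W K) := by
    intro B
    by_cases hB : B ∈ R.idbBody
    · obtain ⟨Y, hY, hBY⟩ := hR.adornment_mem B hB
      obtain ⟨ρ, hρ⟩ := exists_perm_into (hY.trans hW.ge)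
      exact ⟨ρ, fun _ => Adornment.rename_mem_adornmentsOver hρ hBY⟩
    · exact ⟨1, fun h => absurd h hB⟩
  choose ρ hρ using h
  refine ⟨⟨R.head.rename π,
    R.idbBody.map fun B => ⟨B.atom.map (Term.rename π), B.adornment.rename (ρ B)⟩,
    R.edbBody.map (Atom.map (Term.rename π))⟩, ⟨⟨Atom.rename_mem_atomsOver hπ hhead,
    Adornment.rename_mem_adornmentsOver hπ hadn⟩, ⟨by simpa using hR.length_idbBody_le, ?_⟩,
    by simpa using hR.length_edbBody_le, ?_⟩, π, rfl, ?_, rfl⟩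
  · intro B' hB'
    obtain ⟨B, hB, rfl⟩ := List.mem_map.1 hB'
    exact ⟨Atom.rename_mem_atomsOver hπ (hidb B hB), hρ B hB⟩
  · intro a' ha'
    obtain ⟨a, ha, rfl⟩ := List.mem_map.1 ha'
    exact Atom.rename_mem_atomsOver hπ (hedb a ha)
  · rw [List.forall₂_map_right_iff]
    exact List.forall₂_same.2 fun B _ => ⟨rfl, ρ B, rfl⟩

/-- The predicates of a program. -/
def Program.preds (prog : Program ar V C) : Set P :=
  {p | ∃ R ∈ prog, R.head.pred = p ∨ ∃ a ∈ R.body, a.pred = p}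

/-- The constants of a program. -/
def Program.consts (prog : Program ar V C) : Set C :=
  {c | ∃ R ∈ prog, c ∈ R.head.consts ∨ ∃ a ∈ R.body, c ∈ a.consts}

lemma Program.finite_preds (prog : Program ar V C) : prog.preds.Finite := by
  refine ((prog.finite_toSet.image fun R => R.head.pred).union
    (prog.finite_toSet.biUnion fun R _ => (List.finite_toSet R.body).image Atom.pred)).subset ?_
  rintro p ⟨R, hR, rfl | ⟨a, ha, rfl⟩⟩
  · exact Or.inl ⟨R, hR, rfl⟩
  · exact Or.inr (Set.mem_biUnion (x := R) hR ⟨a, ha, rfl⟩)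

lemma Atom.finite_consts (a : Atom ar (Term V C)) : a.consts.Finite := by
  refine (Set.finite_range fun i => a.args i).preimage (f := Term.const)
    (fun _ _ _ _ h => Term.const.inj h) |>.subset ?_
  rintro x ⟨i, hi⟩
  exact ⟨i, hi⟩

lemma Program.finite_consts (prog : Program ar V C) : prog.consts.Finite := by
  refine (prog.finite_toSet.biUnion fun R _ => (R.head.finite_consts).union
    ((List.finite_toSet R.body).biUnion fun a _ => a.finite_consts)).subset ?_
  rintro c ⟨R, hR, hc | ⟨a, ha, hc⟩⟩
  · exact Set.mem_biUnion (x := R) hR (Or.inl hc)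
  · exact Set.mem_biUnion (x := R) hR (Or.inr (Set.mem_biUnion (x := a) ha hc))

lemma Atom.consts_rename (π : Equiv.Perm V) (a : Atom ar (Term V C)) :
    (a.map (Term.rename π)).consts = a.consts := by
  ext c
  refine exists_congr fun i => ?_
  change (a.args i).rename π = _ ↔ _
  cases a.args i <;> simp [Term.rename]

lemma Atom.consts_subset_of_mem_atomsOver {Q : Set P} {X : Set V} {K : Set C}
    {a : Atom ar (Term V C)} (ha : a ∈ atomsOver Q (termsOver X K)) : a.consts ⊆ K := by
  rintro c ⟨i, hi⟩
  rcases ha.2 i with ⟨x, -, hx⟩ | ⟨d, hd, hdi⟩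
  · exact absurd (hi.symm.trans hx) (by simp)
  · rwa [Term.const.inj (hi.symm.trans hdi)]

/-- The bounds do not grow from step to step. All variables of the new rule and of its head
adornment are of the form `σ x` with `x` in `R`, because relaxation keeps only head variables; the
body adornments are inherited unchanged, and `σ` brings in no new constants. -/
lemma bounded_of_constructs {prog : Program ar V C} {adn : AdornedProgram ar V C}
    {L M : ℕ} (hL : ∀ R ∈ prog, R.body.length ≤ L)
    (hM : ∀ R ∈ prog, R.finite_vars.toFinset.card ≤ M)
    (hadn : ∀ R ∈ adn, R.Bounded prog.preds prog.consts L M)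
    {R' : AdornedRule ar V C} (hR' : Constructs gOut prog adn R') :
    R'.Bounded prog.preds prog.consts L M := by
  classical
  obtain ⟨R, hR, c, π, σ, hc, -, -, hσ, rfl⟩ := hR'
  have hmem := fun i : Fin (prog.idbBody R).length =>
    (Program.mem_idbBody.1 (List.get_mem (prog.idbBody R) i)).1
  -- Where `σ x` is a constant, `x` is a harmless filler: `X` is still an image of the variables of
  -- `R`.
  let f : V → V := fun x => match σ x with
    | .var y => y
    | .const _ => x
  let X := R.finite_vars.toFinset.image f
  have hX : X.card ≤ M := Finset.card_image_le.trans (hM R hR)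
  have hconst : ∀ x d, σ x = .const d → d ∈ prog.consts := by
    intro x d hd
    obtain ⟨_, ⟨i, rfl⟩, h | h⟩ := hσ.const_mem hd
    · exact ⟨R, hR, Or.inr ⟨_, hmem i, h⟩⟩
    · obtain ⟨Y, -, hY, -⟩ := (hadn _ (hc i).1).exists_vars
      change d ∈ ((c i).head.atom.map (Term.rename (π i))).consts at h
      rw [Atom.consts_rename] at h
      exact Atom.consts_subset_of_mem_atomsOver hY h
  have hvar : ∀ x ∈ R.vars, σ x ∈ termsOver ↑X prog.consts := by
    intro x hx
    cases h : σ x with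
    | var y =>
      refine Or.inl ⟨y, Finset.mem_coe.2 (Finset.mem_image.2 ⟨x, by simpa using hx, ?_⟩), rfl⟩
      simp only [f, h]
    | const d => exact Or.inr ⟨d, hconst x d h, rfl⟩
  have hatom : ∀ a : Atom ar (Term V C), a.pred ∈ prog.preds → a.vars ⊆ R.vars →
      a.consts ⊆ prog.consts →
      a.map (Term.subst σ) ∈ atomsOver prog.preds (termsOver ↑X prog.consts) := by
    intro a hp hv hk
    refine ⟨hp, fun i => ?_⟩
    change (a.args i).subst σ ∈ _
    cases h : a.args i with
    | var y => exact hvar y (hv ⟨i, h⟩)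
    | const d => exact Or.inr ⟨d, hk ⟨i, h⟩, rfl⟩
  have hbody : ∀ a ∈ R.body,
      a.map (Term.subst σ) ∈ atomsOver prog.preds (termsOver ↑X prog.consts) := fun a ha =>
    hatom a ⟨R, hR, Or.inr ⟨a, ha, rfl⟩⟩ (fun x hx => Or.inr ⟨a, ha, hx⟩)
      fun d hd => ⟨R, hR, Or.inr ⟨a, ha, hd⟩⟩
  have hhead : R.head.map (Term.subst σ) ∈ atomsOver prog.preds (termsOver ↑X prog.consts) :=
    hatom _ ⟨R, hR, Or.inl rfl⟩ (fun x hx => Or.inl hx) fun d hd => ⟨R, hR, Or.inl hd⟩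
  refine ⟨⟨X, hX, hhead, ⟨hhead, fun a ha => ?_⟩, fun B hB => ?_, fun a ha => ?_⟩,
    fun B hB => ?_, ?_, ?_⟩
  · obtain ⟨⟨b, hb, rfl⟩, -⟩ := mem_body_gOut.1 ha
    refine ⟨?_, fun i => ?_⟩
    · rcases mem_body_inlinedAdornment.1 hb with ⟨i, b', hb', rfl⟩ | ⟨b', hb', rfl⟩
      · obtain ⟨b'', hb'', rfl⟩ := Adornment.mem_body_rename.1 hb'
        obtain ⟨Y, -, -, hY, -⟩ := (hadn _ (hc i).1).exists_vars
        exact (hY.2 b'' hb'').1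
      · exact ⟨R, hR, Or.inr ⟨b', (Program.mem_edbBody.1 hb').1, rfl⟩⟩
    · change maskArg _ (b.args i) ∈ _
      rcases h : maskArg (inlinedAdornment prog R (fun i => (c i).head.rename (π i)) σ).head.vars
          (b.args i) with _ | t
      · exact Or.inl rfl
      · obtain ⟨-, x, ⟨j, hj⟩, rfl⟩ := maskArg_eq_some.1 h
        refine Or.inr ⟨_, ?_, rfl⟩
        rw [← hj]
        exact hhead.2 j
  · obtain ⟨i, rfl⟩ := List.mem_ofFn.1 hB
    exact hbody _ (hmem i)
  · obtain ⟨b, hb, rfl⟩ := List.mem_map.1 ha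
    exact hbody b (Program.mem_edbBody.1 hb).1
  · obtain ⟨i, rfl⟩ := List.mem_ofFn.1 hB
    obtain ⟨Y, hY, -, hYa, -⟩ := (hadn _ (hc i).1).exists_vars
    exact ⟨Y, hY, hYa⟩
  · simp only [List.length_ofFn]
    exact (List.length_filter_le _ _).trans (hL R hR)
  · simp only [List.length_map]
    exact (List.length_filter_le _ _).trans (hL R hR)

/-- The adornment algorithm terminates. -/
theorem exists_isAlgorithmOutput [Infinite V] (prog : Program ar V C) :
    ∃ adn, IsAlgorithmOutput gOut hEq prog adn := by
  let L := prog.sup fun R => R.body.length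
  let M := prog.sup fun R => R.finite_vars.toFinset.card
  have hL : ∀ R ∈ prog, R.body.length ≤ L := fun R hR =>
    Finset.le_sup (f := fun R : Rule ar V C => R.body.length) hR
  have hM : ∀ R ∈ prog, R.finite_vars.toFinset.card ≤ M := fun R hR =>
    Finset.le_sup (f := fun R : Rule ar V C => R.finite_vars.toFinset.card) hR
  obtain ⟨W, hW⟩ := Infinite.exists_subset_card_eq V M
  have hfin := finite_adornedRulesOver (ar := ar) prog.finite_preds
    (finite_termsOver W.finite_toSet prog.finite_consts) L
  refine exists_output_of_representatives hfin.toFinset fun adn hadn R hR => ?_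
  have hbdd := forall_mem_of_reachable
    (fun adn R' ih hR' => bounded_of_constructs hL hM ih hR') hadn
  obtain ⟨S, hS, hRS⟩ := (bounded_of_constructs hL hM hbdd hR).exists_representative hW
  exact ⟨S, hfin.mem_toFinset.2 hS, hRS⟩

end Termination

/-! ### Programs and instances that attain the bound. -/

section Tightness

/-- The predicates of the programs that attain the size bound: one output predicate of arity `μ`,
and `m` EDB predicates of arity `ν`. -/
def tightAr (μ ν m : ℕ) : Option (Fin m) → ℕ
  | none => μ
  | some _ => ν

/-- The rule whose body consists of `ω` variable-disjoint atoms, with predicates given by `e`. The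
`i`-th argument of the head is the variable at position `p i` of the body atom `κ i`. -/
def tightRule {ω μ ν m : ℕ} (κ : Fin μ → Fin ω) (e : Fin ω → Fin m) (p : Fin μ → Fin ν) :
    Rule (tightAr μ ν m) ℕ ℕ where
  head := ⟨none, fun i : Fin μ => .var (Nat.pair (κ i) (p i))⟩
  body := List.ofFn fun l => ⟨some (e l), fun j : Fin ν => .var (Nat.pair l j)⟩

-- All choices of `κ`, `e` and `p` are included, so that every combination of at most `ω` facts and
-- of positions in them is realised by some rule.
open Classical in
noncomputable def tightProgram (ω μ ν m : ℕ) : Program (tightAr μ ν m) ℕ ℕ :=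
  Finset.univ.image fun x : (Fin μ → Fin ω) × (Fin ω → Fin m) × (Fin μ → Fin ν) =>
    tightRule x.1 x.2.1 x.2.2

/-- The arguments of the `n`-th fact on the `j`-th EDB predicate. They are different, and no two
facts share a constant. -/
def tightArgs (ν : ℕ) {m : ℕ} (j : Fin m) (n : ℕ) (i : Fin ν) : ℕ := Nat.pair (Nat.pair j n) i

def tightFact (μ ν m : ℕ) (j : Fin m) (n : ℕ) : Atom (tightAr μ ν m) ℕ :=
  ⟨some j, tightArgs ν j n⟩

def tightInstance (μ ν m N : ℕ) : Set (Atom (tightAr μ ν m) ℕ) :=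
  {A | ∃ j, ∃ n < N, A = tightFact μ ν m j n}

variable {ω μ ν m : ℕ}

lemma mem_tightProgram {R : Rule (tightAr μ ν m) ℕ ℕ} :
    R ∈ tightProgram ω μ ν m ↔
      ∃ (κ : Fin μ → Fin ω) (e : Fin ω → Fin m) (p : Fin μ → Fin ν), tightRule κ e p = R := by
  classical
  simp [tightProgram]

lemma tightProgram_safe : (tightProgram ω μ ν m).Safe := by
  intro R hR x hx
  obtain ⟨κ, e, p, rfl⟩ := mem_tightProgram.1 hR
  obtain ⟨i, hi⟩ := hx
  exact ⟨_, (List.mem_ofFn' _ _).2 ⟨κ i, rfl⟩, p i, hi⟩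

lemma pred_of_mem_body {R : Rule (tightAr μ ν m) ℕ ℕ} (hR : R ∈ tightProgram ω μ ν m)
    {a : Atom (tightAr μ ν m) (Term ℕ ℕ)} (ha : a ∈ R.body) : ∃ j, a.pred = some j := by
  obtain ⟨κ, e, p, rfl⟩ := mem_tightProgram.1 hR
  obtain ⟨l, rfl⟩ := (List.mem_ofFn' _ _).1 ha
  exact ⟨e l, rfl⟩

lemma not_isIDB_some (j : Fin m) : ¬ (tightProgram ω μ ν m).IsIDB (some j) := by
  rintro ⟨R, hR, hp, -⟩
  obtain ⟨κ, e, p, rfl⟩ := mem_tightProgram.1 hR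
  cases hp

lemma isIDB_none (hω : 1 ≤ ω) (hν : 1 ≤ ν) (hm : 1 ≤ m) : (tightProgram ω μ ν m).IsIDB none := by
  refine ⟨_, mem_tightProgram.2 ⟨fun _ => ⟨0, hω⟩, fun _ => ⟨0, hm⟩, fun _ => ⟨0, hν⟩, rfl⟩, rfl, ?_⟩
  intro h
  have := congrArg List.length h
  simp [tightRule] at this
  omega

lemma edbs_tightProgram (hω : 1 ≤ ω) (hν : 1 ≤ ν) (hm : 1 ≤ m) :
    (tightProgram ω μ ν m).edbs = Set.range some := by
  ext p
  cases p with
  | none =>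
    simp only [Set.mem_range, reduceCtorEq, exists_false, iff_false]
    exact fun h => h.2 (isIDB_none hω hν hm)
  | some j =>
    simp only [Set.mem_range, Option.some.injEq, exists_eq, iff_true]
    refine ⟨⟨_, mem_tightProgram.2 ⟨fun _ => ⟨0, hω⟩, fun _ => j, fun _ => ⟨0, hν⟩, rfl⟩,
      Or.inr ⟨_, (List.mem_ofFn' _ _).2 ⟨⟨0, hω⟩, rfl⟩, rfl⟩⟩, not_isIDB_some j⟩

lemma numEDBs_tightProgram (hω : 1 ≤ ω) (hν : 1 ≤ ν) (hm : 1 ≤ m) :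
    (tightProgram ω μ ν m).numEDBs = m := by
  rw [Program.numEDBs, edbs_tightProgram hω hν hm, ← Set.image_univ,
    Set.ncard_image_of_injective _ (Option.some_injective _), Set.ncard_univ, Nat.card_fin]

lemma ear_tightProgram (hω : 1 ≤ ω) (hν : 1 ≤ ν) (hm : 1 ≤ m) :
    (tightProgram ω μ ν m).ear = ν := by
  have : tightAr μ ν m '' Set.range some = {ν} := by
    ext k
    simp only [Set.mem_image, Set.mem_range, exists_exists_eq_and, Set.mem_singleton_iff]
    exact ⟨fun ⟨_, h⟩ => h.symm, fun h => ⟨⟨0, hm⟩, h.symm⟩⟩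
  rw [Program.ear, edbs_tightProgram hω hν hm, this, csSup_singleton]

/-! ### Heads and width of the outputs for the tight program. -/

section Width

variable {adn : AdornedProgram (tightAr μ ν m) ℕ ℕ}

lemma variableHeads_tightProgram
    (hadn : IsAlgorithmOutput gOut hEq (tightProgram ω μ ν m) adn) : adn.VariableHeads none := by
  suffices ∀ R ∈ adn, ∀ i, ∃ x, R.head.atom.args i = .var x from fun R hR _ => this R hR
  refine forall_mem_of_reachable (fun adn R' _ hR' => ?_) hadn.1
  obtain ⟨R, hR, c, π, σ, -, -, -, hσ, rfl⟩ := hR'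
  intro i
  change ∃ x, (R.head.args i).subst σ = _
  obtain ⟨κ, e, p, rfl⟩ := mem_tightProgram.1 hR
  change ∃ x, σ (Nat.pair (κ i) (p i)) = _
  cases h : σ (Nat.pair (κ i) (p i)) with
  | var x => exact ⟨x, rfl⟩
  | const d =>
    -- A constant in `σ` would have to come from a pair to be unified, but the bodies have no IDB
    -- atoms and hence there is no pair.
    obtain ⟨_, ⟨k, rfl⟩, -⟩ := hσ.const_mem h
    have hk := Program.mem_idbBody.1 (List.get_mem _ k)
    obtain ⟨j, hj⟩ := pred_of_mem_body hR hk.1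
    exact absurd (hj ▸ hk.2) (not_isIDB_some j)

lemma card_body_gOut_le {P : Type*} {ar : P → ℕ} {V C : Type*} (ρ : Adornment ar V C) :
    (gOut ρ).body.card ≤ ρ.body.card := by
  classical
  exact (Finset.card_filter_le _ _).trans Finset.card_image_le

/-- An adornment arises from `ω` EDB atoms and nothing else, and the whole body of a covered
adornment is an edge cover. -/
lemma ew_tightProgram_le (hadn : IsAlgorithmOutput gOut hEq (tightProgram ω μ ν m) adn) :
    adn.ew none ≤ ω := by
  classical
  have hcard : ∀ R ∈ adn, R.head.adornment.body.card ≤ ω := by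
    refine forall_mem_of_reachable (fun adn R' _ hR' => ?_) hadn.1
    obtain ⟨R, hR, c, π, σ, -, -, -, -, rfl⟩ := hR'
    refine (card_body_gOut_le _).trans ((Finset.card_le_card (t := (R.body.map fun a =>
      a.map fun t => some (Term.subst σ t)).toFinset) fun b hb => ?_).trans
        ((List.toFinset_card_le _).trans ?_))
    · rcases mem_body_inlinedAdornment.1 hb with ⟨i, -⟩ | ⟨a, ha, rfl⟩
      · have hi := Program.mem_idbBody.1 (List.get_mem _ i)
        obtain ⟨j, hj⟩ := pred_of_mem_body hR hi.1
        exact absurd (hj ▸ hi.2) (not_isIDB_some j)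
      · exact List.mem_toFinset.2 (List.mem_map.2 ⟨a, (Program.mem_edbBody.1 ha).1, rfl⟩)
    · obtain ⟨κ, e, p, rfl⟩ := mem_tightProgram.1 hR
      simp [tightRule]
  exact AdornedProgram.ew_le (fun R hR =>
    (wellFormed_of_reachable tightProgram_safe hadn.1 R hR).covered.ew_le_card.trans
      (hcard R hR)) _

end Width

/-! ### Relations over the tight instance. -/

section Instance

variable {N : ℕ}

lemma tightFact_mem_lfp (hω : 1 ≤ ω) (hν : 1 ≤ ν) (hm : 1 ≤ m) (j : Fin m) {n : ℕ} (hn : n < N) :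
    tightFact μ ν m j n ∈
      OrderHom.lfp ((tightProgram ω μ ν m).immediateConsequence (tightInstance μ ν m N)) := by
  rw [← OrderHom.map_lfp]
  refine Or.inl ⟨⟨j, n, hn, rfl⟩, ?_⟩
  rw [edbs_tightProgram hω hν hm]
  exact ⟨j, rfl⟩

lemma relation_some (hω : 1 ≤ ω) (hν : 1 ≤ ν) (hm : 1 ≤ m) (j : Fin m) :
    (tightProgram ω μ ν m).relation (tightInstance μ ν m N) (some j) =
      tightArgs ν j '' (Finset.range N : Set ℕ) := by
  ext t
  constructor
  · intro ht
    -- Rules only derive facts on `none`, so this set is closed under the consequence operator and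
    -- the EDB relations stay as stored.
    have hle : OrderHom.lfp ((tightProgram ω μ ν m).immediateConsequence (tightInstance μ ν m N)) ≤
        {A | A.pred = none ∨ A ∈ tightInstance μ ν m N} := by
      refine OrderHom.lfp_le _ ?_
      rintro A (hA | ⟨R, hR, τ, -, rfl⟩)
      · exact Or.inr hA.1
      · obtain ⟨κ, e, p, rfl⟩ := mem_tightProgram.1 hR
        exact Or.inl rfl
    rcases hle ht with h | ⟨j', n, hn, h⟩
    · cases h
    · obtain ⟨h1, h2⟩ := Atom.mk.inj h
      obtain rfl := Option.some.inj h1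
      exact ⟨n, by simpa using hn, (eq_of_heq h2).symm⟩
  · rintro ⟨n, hn, rfl⟩
    exact tightFact_mem_lfp hω hν hm j (by simpa using hn)

lemma encard_relation_some (hω : 1 ≤ ω) (hν : 1 ≤ ν) (hm : 1 ≤ m) (j : Fin m) :
    ((tightProgram ω μ ν m).relation (tightInstance μ ν m N) (some j)).encard = N := by
  refine (congrArg Set.encard (relation_some hω hν hm j)).trans ?_
  have hinj : Function.Injective (tightArgs ν j) := by
    intro n n' h
    have := congrFun h ⟨0, hν⟩
    simpa [tightArgs] using this
  exact (hinj.encard_image _).trans (by rw [Set.encard_coe_eq_coe_finsetCard, Finset.card_range])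

/-- A function with few values factors through a small index set. -/
lemma exists_factorization {α : Type*} [DecidableEq α] (hμ : 0 < μ) {g : Fin μ → α}
    (hg : (Finset.univ.image g).card ≤ ω) :
    ∃ (κ : Fin μ → Fin ω) (h : Fin ω → α), ∀ i, h (κ i) = g i := by
  obtain ⟨f⟩ : Nonempty (↥(Finset.univ.image g) ↪ Fin ω) :=
    Function.Embedding.nonempty_of_card_le (by simpa using hg)
  refine ⟨fun i => f ⟨g i, Finset.mem_image_of_mem _ (Finset.mem_univ i)⟩,
    -- Unused indices get an actual value of `g`: the rule always has `ω` body atoms, and the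
    -- surplus ones must match facts too.
    Function.extend f Subtype.val fun _ => g ⟨0, hμ⟩, fun i => ?_⟩
  rw [f.injective.extend_apply]

/-- A constant encodes its predicate, fact number and position, so different choices of facts and
positions yield different tuples. If the choice uses at most `ω` facts, it factors through `Fin ω`,
and the rule with these predicates and positions derives the tuple. -/
lemma sizeBound_le_encard_relation (hω : 1 ≤ ω) (hμ : 0 < μ) (hν : 1 ≤ ν) (hm : 1 ≤ m) :
    (sizeBound ω μ m ν N : ℕ) ≤
      ((tightProgram ω μ ν m).relation (tightInstance μ ν m N) none).encard := by
  classical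
  let Φ : (Fin μ → Fin m × Fin N) × (Fin μ → Fin ν) → Fin μ → ℕ :=
    fun x i => Nat.pair (Nat.pair (x.1 i).1 (x.1 i).2) (x.2 i)
  have hΦ : Function.Injective Φ := by
    rintro ⟨g, p⟩ ⟨g', p'⟩ h
    have h' : ∀ i, g i = g' i ∧ p i = p' i := by
      intro i
      have := congrFun h i
      simpa [Φ, Nat.pair_eq_pair, Prod.ext_iff, Fin.ext_iff] using this
    exact Prod.ext (funext fun i => (h' i).1) (funext fun i => (h' i).2)
  rw [sizeBound_eq_card (Fin m × Fin N) hμ ω m ν N (by simp),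
    ← Finset.card_image_of_injective _ hΦ, ← Set.encard_coe_eq_coe_finsetCard]
  refine Set.encard_le_encard fun t ht => ?_
  obtain ⟨⟨g, p⟩, hgp, rfl⟩ := Finset.mem_image.1 (Finset.mem_coe.1 ht)
  obtain ⟨κ, h, hκ⟩ := exists_factorization hμ
    (Finset.mem_filter.1 (Finset.mem_product.1 hgp).1).2
  -- Variable `Nat.pair l j` is position `j` of body atom `l`, which is matched with the fact `h l`;
  -- the value `0` is for variables outside the rule.
  let τ : ℕ → ℕ := fun v =>
    if hv : v.unpair.1 < ω then
      Nat.pair (Nat.pair (h ⟨_, hv⟩).1 (h ⟨_, hv⟩).2) v.unpair.2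
    else 0
  have hτ : ∀ (l : Fin ω) (j : ℕ),
      τ (Nat.pair l j) = Nat.pair (Nat.pair (h l).1 (h l).2) j := by
    intro l j
    simp [τ, Nat.unpair_pair]
  change (⟨none, _⟩ : Atom (tightAr μ ν m) ℕ) ∈
    OrderHom.lfp ((tightProgram ω μ ν m).immediateConsequence (tightInstance μ ν m N))
  rw [← OrderHom.map_lfp]
  refine Or.inr ⟨tightRule κ (fun l => (h l).1) p, mem_tightProgram.2 ⟨_, _, _, rfl⟩, τ,
    fun B hB => ?_, ?_⟩
  · obtain ⟨l, rfl⟩ := (List.mem_ofFn' _ _).1 hB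
    have := tightFact_mem_lfp (μ := μ) hω hν hm (h l).1 (h l).2.2
    convert this using 1
    simp only [Atom.map, tightFact]
    congr 1
    funext j
    exact hτ l j
  · simp only [Atom.map, tightRule]
    congr 1
    funext i
    exact (hκ i ▸ (hτ (κ i) (p i)).symm :)

end Instance

/-- The lower bound needs no analysis of the hypergraphs: a smaller width would make the general
size bound strictly smaller than the number of tuples that are actually derived. -/
lemma ew_tightProgram (hω : 1 ≤ ω) (hωμ : ω ≤ μ) (hν : 1 ≤ ν) (hm : 1 ≤ m)
    {adn : AdornedProgram (tightAr μ ν m) ℕ ℕ}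
    (hadn : IsAlgorithmOutput gOut hEq (tightProgram ω μ ν m) adn) : adn.ew none = ω := by
  refine (ew_tightProgram_le hadn).antisymm (not_lt.1 fun hlt => ?_)
  -- With `N = ω` there are at least `ω` facts, so the summand at `k = ω` is not zero.
  have h1 := sizeBound_le_encard_relation (N := ω) hω (hω.trans hωμ) hν hm
  have h2 := encard_relation_le tightProgram_safe hadn (isIDB_none hω hν hm)
    (hω.trans hωμ) (variableHeads_tightProgram hadn) (tightInstance μ ν m ω) (N := ω) <| by
      rw [edbs_tightProgram hω hν hm]
      rintro _ ⟨j, rfl⟩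
      exact (encard_relation_some hω hν hm j).le
  rw [numEDBs_tightProgram hω hν hm, ear_tightProgram hω hν hm] at h2
  have h3 := h1.trans h2
  rw [Nat.cast_le] at h3
  exact (sizeBound_lt_of_lt (a := μ) (m := m) (r := ν) (N := ω) hlt hωμ hν
    (Nat.le_mul_of_pos_left ω hm)).not_ge h3

/-- The upper half is the general bound, for which termination supplies an output of the algorithm.
-/
lemma encard_relation_none (hω : 1 ≤ ω) (hωμ : ω ≤ μ) (hν : 1 ≤ ν) (hm : 1 ≤ m) (N : ℕ) :
    ((tightProgram ω μ ν m).relation (tightInstance μ ν m N) none).encard =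
      (sizeBound ω μ m ν N : ℕ) := by
  obtain ⟨adn, hadn⟩ := exists_isAlgorithmOutput (tightProgram ω μ ν m)
  refine le_antisymm ?_ (sizeBound_le_encard_relation hω (hω.trans hωμ) hν hm)
  have h := encard_relation_le tightProgram_safe hadn (isIDB_none hω hν hm)
    (hω.trans hωμ) (variableHeads_tightProgram hadn) (tightInstance μ ν m N) (N := N) <| by
      rw [edbs_tightProgram hω hν hm]
      rintro _ ⟨j, rfl⟩
      exact (encard_relation_some hω hν hm j).le
  rwa [numEDBs_tightProgram hω hν hm, ear_tightProgram hω hν hm,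
    ew_tightProgram hω hωμ hν hm hadn] at h

end Tightness

end Datalog

theorem mainTheorem3 :
    -- the size bounds
    (∀ (P : Type*) (ar : P → ℕ) (V : Type*) (C : Type*) [Infinite V] (prog : Program ar V C),
      prog.Safe →
      (∃ adn, IsAlgorithmOutput gOut hEq prog adn) ∧
      ∀ adn, IsAlgorithmOutput gOut hEq prog adn →
        ∀ q, prog.IsIDB q → 0 < ar q → adn.VariableHeads q →
          ∀ (D : Set (Atom ar C)) (N : ℕ),
            (∀ e ∈ prog.edbs, (prog.relation D e).encard ≤ N) →
            (prog.relation D q).encard ≤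
                (sizeBound (adn.ew q) (ar q) prog.numEDBs prog.ear N : ℕ) ∧
              sizeBound (adn.ew q) (ar q) prog.numEDBs prog.ear N ≤
                (prog.numEDBs * prog.ear * ar q) ^ ar q * N ^ adn.ew q) ∧
    -- tightness of the first bound, for every choice of the parameters
    (∀ ω μ ν m : ℕ, 1 ≤ ω → ω ≤ μ → 1 ≤ ν → 1 ≤ m →
      ∃ (P : Type) (ar : P → ℕ) (prog : Program ar ℕ ℕ) (q : P),
        prog.Safe ∧ prog.IsIDB q ∧ ar q = μ ∧ prog.numEDBs = m ∧ (∀ e ∈ prog.edbs, ar e = ν) ∧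
        (∀ adn, IsAlgorithmOutput gOut hEq prog adn → adn.VariableHeads q ∧ adn.ew q = ω) ∧
        ∀ N : ℕ, ∃ D : Set (Atom ar ℕ),
          (∀ e ∈ prog.edbs, (prog.relation D e).encard = N) ∧
          (prog.relation D q).encard = (sizeBound ω μ m ν N : ℕ)) := by
  refine ⟨fun P ar V C _ prog hsafe => ⟨exists_isAlgorithmOutput prog,
    fun adn hadn q hq hpos hvar D N hN =>
      ⟨encard_relation_le hsafe hadn hq hpos hvar D hN, sizeBound_le_pow _ _ _ _ _⟩⟩, ?_⟩
  intro ω μ ν m hω hωμ hν hm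
  refine ⟨Option (Fin m), tightAr μ ν m, tightProgram ω μ ν m, none, tightProgram_safe,
    isIDB_none hω hν hm, rfl, numEDBs_tightProgram hω hν hm, ?_, fun adn hadn =>
      ⟨variableHeads_tightProgram hadn, ew_tightProgram hω hωμ hν hm hadn⟩,
    fun N => ⟨tightInstance μ ν m N, ?_, encard_relation_none hω hωμ hν hm N⟩⟩
  · rw [edbs_tightProgram hω hν hm]
    rintro _ ⟨j, rfl⟩
    rfl
  · rw [edbs_tightProgram hω hν hm]
    rintro _ ⟨j, rfl⟩
    exact encard_relation_some hω hν hm j
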